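/- Let $d,k\in\mathbb N$, $y\in\mathbb R^k$, and let $\sigma,\varepsilon,\lambda,L>0$, $M\ge 0$ and $m,K\in\mathbb R$ satisfy $$2\lambda\Big(L+\frac{M+1}{\varepsilon}-\min(m,0)\Big)\le 1 .$$ Let $D_\varepsilon:\mathbb R^d\to\mathbb R^d$ be $M$-Lipschitz (the denoiser), and let $\mathbb S\subset\mathbb R^d$ be nonempty, convex and compact, with orthogonal projection $\Pi_{\mathbb S}$. For $A\in\mathbb R^{k\times d}$ let $p_A(y|x)=(2\pi\sigma^2)^{-k/2}\exp\big(-\|y-Ax\|^2/(2\sigma^2)\big)$ be the likelihood, let $$b_A(x)=\nabla_x\log p_A(y|x)+\frac1\varepsilon\big(D_\varepsilon(x)-x\big)+\frac1\lambda\big(\Pi_{\mathbb S}(x)-x\big),$$ and, for $\delta>0$, consider the Markov chain (PnP-ULA) $$x_{j+1}=x_j+\delta\, b_A(x_j)+\sqrt{2\delta}\,z_{j+1},\qquad z_{j+1}\sim\mathcal N(0,I_d)\ \text{i.i.d.}$$ Put $\bar\delta=\frac13\big(L+\frac{M+1}{\varepsilon}+\frac1\lambda\big)^{-1}$. Then there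 exist constants $A_4,B_4\ge 0$ (depending on the data above, but not on $A^1,A^2,\delta$) such that the following holds. Let $A^1,A^2\in\mathbb R^{k\times d}$ have operator norm at most $K$, and suppose that, for $i=1,2$, the score $\nabla\log p_{A^i}(y|\cdot)$ is $L$-Lipschitz and satisfies $$\langle\nabla\log p_{A^i}(y|x_2)-\nabla\log p_{A^i}(y|x_1),\,x_2-x_1\rangle\le -m\|x_2-x_1\|^2\qquad\text{for all }x_1,x_2\in\mathbb R^d.$$ Let $\delta\in(0,\bar\delta]$ and, for $i=1,2$, let $\pi^i$ be an invariant probability measure of the chain with drift $b_{A^i}$ and step size $\delta$. Then $$\|\pi^1-\pi^2\|_{TV}\le A_4\,\|A^1-A^2\|+B_4\,\delta^{1/4},$$ where $\|\cdot\|$ is the Euclidean operator norm on matrices and $\|\mu\|_{TV}=\sup\{|\int f\,d\mu| : f \text{ measurable},\ \|f\|_\infty\le1\}$. -/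

import Mathlib

open scoped Matrix.Norms.L2Operator

noncomputable section

namespace PnPULA

open MeasureTheory ProbabilityTheory

/-- `ℝⁿ` with its Euclidean norm. -/
abbrev Euc (n : ℕ) : Type := EuclideanSpace ℝ (Fin n)

/-- The likelihood `p(y | x)` of the observation model `y = A x + n`, `n ∼ 𝒩(0, σ² I)`: the density
at `y` of the Gaussian law `𝒩(A x, σ² I)` on `ℝᵏ`. -/
def likelihood {d k : ℕ} (σ : ℝ) (A : Matrix (Fin k) (Fin d) ℝ) (y : Euc k) (x : Euc d) : ℝ :=
  (2 * Real.pi * σ ^ 2) ^ (-(k : ℝ) / 2) *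
    Real.exp (-‖y - Matrix.toEuclideanLin A x‖ ^ 2 / (2 * σ ^ 2))

/-- The likelihood score `x ↦ ∇ₓ log p(y | x)`. -/
def likelihoodScore {d k : ℕ} (σ : ℝ) (A : Matrix (Fin k) (Fin d) ℝ) (y : Euc k) (x : Euc d) :
    Euc d :=
  gradient (fun x' => Real.log (likelihood σ A y x')) x

open Classical in
/-- The orthogonal projection onto `S`: a point of `S` at minimal distance from `x`
(for `S` nonempty, convex and compact it exists and is unique, see below; the value is `x` when
there is no such point). -/
def projOnto {d : ℕ} (S : Set (Euc d)) (x : Euc d) : Euc d :=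
  if h : ∃ p ∈ S, ∀ z ∈ S, ‖x - p‖ ≤ ‖x - z‖ then h.choose else x

theorem projOnto_spec {d : ℕ} {S : Set (Euc d)} (hne : S.Nonempty) (hS : IsCompact S)
    (x : Euc d) : projOnto S x ∈ S ∧ ∀ z ∈ S, ‖x - projOnto S x‖ ≤ ‖x - z‖ := by
  have h : ∃ p ∈ S, ∀ z ∈ S, ‖x - p‖ ≤ ‖x - z‖ := by
    obtain ⟨p, hp, hd⟩ := hS.exists_infDist_eq_dist hne x
    refine ⟨p, hp, fun z hz => ?_⟩
    rw [← dist_eq_norm, ← dist_eq_norm, ← hd]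
    exact Metric.infDist_le_dist_of_mem hz
  unfold projOnto
  rw [dif_pos h]
  exact h.choose_spec

/-- The PnP-ULA drift
`b_ε(x) = ∇ log p(y | x) + (D_ε(x) - x) / ε + (Π_S(x) - x) / λ`. -/
def drift {d k : ℕ} (σ ε lam : ℝ) (D : Euc d → Euc d) (S : Set (Euc d)) (y : Euc k)
    (A : Matrix (Fin k) (Fin d) ℝ) (x : Euc d) : Euc d :=
  likelihoodScore σ A y x + (1 / ε) • (D x - x) + (1 / lam) • (projOnto S x - x)

/-- One step of the Markov chain `x_{j+1} = x_j + δ b(x_j) + √(2δ) z_{j+1}` with standard Gaussian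
`z_{j+1}`, started at `x`: the probability measure `R_δ(x, ·)`. -/
def ulaStep {d : ℕ} (δ : ℝ) (b : Euc d → Euc d) (x : Euc d) : Measure (Euc d) :=
  (stdGaussian (Euc d)).map (fun z => x + δ • b x + Real.sqrt (2 * δ) • z)

/-- `π` is an invariant probability measure of the Markov chain with step size `δ` and drift `b`:
`π R_δ = π`. -/
def IsInvariantLaw {d : ℕ} (δ : ℝ) (b : Euc d → Euc d) (π : Measure (Euc d)) : Prop :=
  IsProbabilityMeasure π ∧ ∀ B : Set (Euc d), MeasurableSet B → ∫⁻ x, ulaStep δ b x B ∂π = π B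

/-- `‖μ - ν‖_TV = sup_{‖f‖_∞ ≤ 1} |∫ f dμ - ∫ f dν|`, the supremum over measurable `f`. -/
def tvDist {d : ℕ} (μ ν : Measure (Euc d)) : ℝ :=
  sSup {r : ℝ | ∃ f : Euc d → ℝ, Measurable f ∧ (∀ x, |f x| ≤ 1) ∧
    r = |∫ x, f x ∂μ - ∫ x, f x ∂ν|}

/-- The supremum that defines `tvDist` is over a bounded set. -/
theorem bddAbove_tvDist {d : ℕ} (μ ν : Measure (Euc d)) [IsProbabilityMeasure μ]
    [IsProbabilityMeasure ν] :
    BddAbove {r : ℝ | ∃ f : Euc d → ℝ, Measurable f ∧ (∀ x, |f x| ≤ 1) ∧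
      r = |∫ x, f x ∂μ - ∫ x, f x ∂ν|} := by
  refine ⟨2, ?_⟩
  rintro r ⟨f, -, hf, rfl⟩
  have key : ∀ (ρ : Measure (Euc d)) [IsProbabilityMeasure ρ], |∫ x, f x ∂ρ| ≤ 1 := by
    intro ρ _
    have h := norm_integral_le_of_norm_le_const (μ := ρ) (f := f) (C := 1)
      (Filter.Eventually.of_forall hf)
    simpa using h
  have h1 := abs_le.mp (key μ)
  have h2 := abs_le.mp (key ν)
  rw [abs_le]
  constructor <;> linarith [h1.1, h1.2, h2.1, h2.2]

/-- The likelihood score `∇ log p(y | ·)` is `L`-Lipschitz. -/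
def ScoreLipschitz {d k : ℕ} (σ : ℝ) (y : Euc k) (L : ℝ) (A : Matrix (Fin k) (Fin d) ℝ) : Prop :=
  ∀ x₁ x₂ : Euc d, ‖likelihoodScore σ A y x₁ - likelihoodScore σ A y x₂‖ ≤ L * ‖x₁ - x₂‖

/-- `⟨∇ log p(y | x₂) - ∇ log p(y | x₁), x₂ - x₁⟩ ≤ -m ‖x₂ - x₁‖²` for all `x₁`, `x₂`. -/
def ScoreMonotone {d k : ℕ} (σ : ℝ) (y : Euc k) (m : ℝ) (A : Matrix (Fin k) (Fin d) ℝ) : Prop :=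
  ∀ x₁ x₂ : Euc d, inner ℝ (likelihoodScore σ A y x₂ - likelihoodScore σ A y x₁) (x₂ - x₁) ≤
    -m * ‖x₂ - x₁‖ ^ 2

end PnPULA

end

/-! Write `R₁`, `R₂` for the one-step Markov operators. Everything rests on a bound, uniform in `n`,
for the oscillation of the partial sums `F n = ∑_{i<n} R₂ⁱ f` of the Poisson equation, where `|f| ≤
1`. Invariance gives `(π₁ - π₂)(F (n+1)) = (π₁ - π₂)(F n) + (π₁ - π₂)(f) + π₁((R₂ - R₁) (F n))`.
Summing and dividing by `n` removes the bounded left side, so `|(π₁ - π₂)(f)|` is at most a bound on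
`|π₁((R₂ - R₁) (F n))|` that holds for all `n` (`abs_integral_sub_le_of_invariant`).

The oscillation is measured by `Φ(t) = J + (t + C(1 - exp(-κt)))/δ`. If `g` oscillates by at most
`Φ`, then `R₂ g` oscillates by at most `Φ - 2` (`exists_potential`). Adding `f`, of oscillation at
most 2, restores `Φ`. The decrease comes from a reflection argument for two Gaussians: far apart,
the drift contracts; at moderate distance, the concavity of `Φ` pays; within the noise scale, the
overlap of the Gaussians saves a share of the jump `J`.

The same reflection bound gives `|R₁ g - R₂ g| ≤ Q‖b₁ - b₂‖` with `Q` free of `δ`: the slope of `Φ`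
is of order `1/δ` and the means differ by `δ‖b₁ - b₂‖` (`abs_integral_stdGaussian_sub_le_mul`). The
drifts differ only in the score, by at most `‖A₁ - A₂‖` times an affine function of `‖x‖`, whose
integral a moment bound controls. For `δ` below a threshold `δ₀` no `δ`-term is needed; the term in
`δ^(1/4)` only serves to make the claim trivial for larger steps. -/

noncomputable section

/-! ### Two unit Gaussians on the line: reflection and overlap. -/

namespace PnPULA
open MeasureTheory ProbabilityTheory Real

/-- The difference of the unit-variance Gaussian densities centred at `c` and `-c`. -/
def gaussDiff (c y : ℝ) : ℝ := gaussianPDFReal c 1 y - gaussianPDFReal (-c) 1 y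

lemma gaussianPDFReal_one (c y : ℝ) :
    gaussianPDFReal c 1 y = (√(2 * π))⁻¹ * exp (-(y - c) ^ 2 / 2) := by
  simp [gaussianPDFReal]

lemma gaussianPDFReal_neg_neg (c y : ℝ) :
    gaussianPDFReal (-c) 1 (-y) = gaussianPDFReal c 1 y := by
  rw [gaussianPDFReal_one, gaussianPDFReal_one]; congr 3; ring

lemma gaussDiff_neg (c y : ℝ) : gaussDiff c (-y) = -gaussDiff c y := by
  have h := gaussianPDFReal_neg_neg (-c) y
  rw [neg_neg] at h
  rw [gaussDiff, gaussDiff, gaussianPDFReal_neg_neg, h]; ring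

lemma gaussDiff_eq (c y : ℝ) :
    gaussDiff c y = gaussianPDFReal c 1 y * (1 - exp (-(2 * c * y))) := by
  rw [gaussDiff, gaussianPDFReal_one, gaussianPDFReal_one, mul_assoc, mul_sub, mul_one, ← exp_add,
    mul_sub]
  congr 3; ring_nf

lemma gaussDiff_nonneg {c y : ℝ} (hc : 0 ≤ c) (hy : 0 ≤ y) : 0 ≤ gaussDiff c y := by
  rw [gaussDiff_eq]
  refine mul_nonneg (gaussianPDFReal_nonneg _ _ _) ?_
  have : exp (-(2 * c * y)) ≤ 1 := exp_le_one_iff.2 (by nlinarith [mul_nonneg hc hy])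
  linarith

lemma abs_gaussDiff_neg (c y : ℝ) : |gaussDiff c (-y)| = |gaussDiff c y| := by
  rw [gaussDiff_neg, abs_neg]

lemma integrable_gaussDiff (c : ℝ) : Integrable (gaussDiff c) :=
  (integrable_gaussianPDFReal _ _).sub (integrable_gaussianPDFReal _ _)

lemma integrable_mul_gaussianPDFReal {c : ℝ} {k : ℝ → ℝ}
    (hk : Integrable k (gaussianReal c 1)) : Integrable (fun y => k y * gaussianPDFReal c 1 y) := by
  rw [gaussianReal_of_var_ne_zero _ one_ne_zero,
    integrable_withDensity_iff (measurable_gaussianPDF _ _)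
      (Filter.Eventually.of_forall fun _ => gaussianPDF_lt_top)] at hk
  simpa [toReal_gaussianPDF] using hk

lemma integral_gaussianReal_one (c : ℝ) (k : ℝ → ℝ) :
    ∫ y, k y ∂gaussianReal c 1 = ∫ y, k y * gaussianPDFReal c 1 y := by
  rw [integral_gaussianReal_eq_integral_smul one_ne_zero]
  simp [mul_comm]

lemma integrable_mul_gaussDiff {c : ℝ} {k : ℝ → ℝ} (h1 : Integrable k (gaussianReal c 1))
    (h2 : Integrable k (gaussianReal (-c) 1)) : Integrable (fun y => k y * gaussDiff c y) := by
  simp only [gaussDiff, mul_sub]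
  exact (integrable_mul_gaussianPDFReal h1).sub (integrable_mul_gaussianPDFReal h2)

lemma integral_mul_gaussDiff {c : ℝ} {k : ℝ → ℝ} (h1 : Integrable k (gaussianReal c 1))
    (h2 : Integrable k (gaussianReal (-c) 1)) :
    ∫ y, k y * gaussDiff c y = ∫ y, k y ∂gaussianReal c 1 - ∫ y, k y ∂gaussianReal (-c) 1 := by
  rw [integral_gaussianReal_one, integral_gaussianReal_one, ← integral_sub
    (integrable_mul_gaussianPDFReal h1) (integrable_mul_gaussianPDFReal h2)]
  simp [gaussDiff, mul_sub]

lemma abs_mul_abs_gaussDiff {c : ℝ} (hc : 0 ≤ c) (y : ℝ) :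
    |y| * |gaussDiff c y| = y * gaussDiff c y := by
  rw [← abs_mul]
  refine abs_of_nonneg ?_
  rcases le_total 0 y with hy | hy
  · exact mul_nonneg hy (gaussDiff_nonneg hc hy)
  · have := gaussDiff_nonneg hc (neg_nonneg.2 hy)
    rw [gaussDiff_neg] at this
    nlinarith

lemma integrable_id_gaussianReal (c : ℝ) : Integrable (fun y : ℝ => y) (gaussianReal c 1) :=
  IsGaussian.integrable_fun_id

lemma integrable_abs_mul_gaussDiff {c : ℝ} (hc : 0 ≤ c) :
    Integrable (fun y => |y| * |gaussDiff c y|) := by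
  simp_rw [abs_mul_abs_gaussDiff hc]
  exact integrable_mul_gaussDiff (integrable_id_gaussianReal _) (integrable_id_gaussianReal _)

/-- `gaussDiff c` has the sign of `y`, so the absolute values drop and the difference of the means
remains. Being an equality, it makes reflection cost nothing on linear functions. -/
lemma integral_abs_mul_gaussDiff {c : ℝ} (hc : 0 ≤ c) :
    ∫ y, |y| * |gaussDiff c y| = 2 * c := by
  simp_rw [abs_mul_abs_gaussDiff hc]
  rw [integral_mul_gaussDiff (integrable_id_gaussianReal _) (integrable_id_gaussianReal _)]
  simp only [integral_id_gaussianReal]; ring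

/-- The total variation mass of the difference of the Gaussians centred at `c` and `-c`. -/
def gaussMass (c : ℝ) : ℝ := 1 / 2 * ∫ y, |gaussDiff c y|

/-- The part of `gaussMass c` carried by the reflection-symmetric set `|y| ∈ I`. -/
def gaussMassOn (I : Set ℝ) (c : ℝ) : ℝ :=
  1 / 2 * ∫ y, I.indicator (fun _ => (1 : ℝ)) |y| * |gaussDiff c y|

lemma integrable_indicator_mul_gaussDiff {I : Set ℝ} (hI : MeasurableSet I) (c : ℝ) :
    Integrable (fun y => I.indicator (fun _ => (1 : ℝ)) |y| * |gaussDiff c y|) := by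
  refine (integrable_gaussDiff c).abs.bdd_mul (c := 1) ?_ ?_
  · exact ((measurable_const.indicator hI).comp measurable_abs).aestronglyMeasurable
  · refine Filter.Eventually.of_forall fun y => ?_
    by_cases h : |y| ∈ I <;> simp [h]

/-- Reflection bound in dimension one. -/
lemma abs_integral_gaussianReal_sub_le {c A B h : ℝ} (hc : 0 ≤ c) {I : Set ℝ}
    (hI : MeasurableSet I) {k : ℝ → ℝ} (hk : Measurable k) {M : ℝ} (hM : ∀ y, |k y| ≤ M)
    (hosc : ∀ y, 0 < y → |k y - k (-y)| ≤ A + B * y - h * I.indicator (fun _ => (1 : ℝ)) y) :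
    |∫ y, k y ∂gaussianReal c 1 - ∫ y, k y ∂gaussianReal (-c) 1| ≤
      A * gaussMass c + B * c - h * gaussMassOn I c := by
  have hint : ∀ c, Integrable k (gaussianReal c 1) := fun c =>
    Integrable.of_bound hk.aestronglyMeasurable M (Filter.Eventually.of_forall hM)
  have hkq := integrable_mul_gaussDiff (hint c) (hint (-c))
  have hkq' : Integrable (fun y => k (-y) * gaussDiff c y) := by
    have := hkq.comp_neg
    simp only [gaussDiff_neg] at this
    simpa using this.neg
  rw [← integral_mul_gaussDiff (hint c) (hint (-c))]
  -- `gaussDiff c` is odd, so only the odd part of `k` contributes.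
  have e1 : ∫ y, k y * gaussDiff c y = 1 / 2 * ∫ y, (k y - k (-y)) * gaussDiff c y := by
    have : ∫ y, k (-y) * gaussDiff c y = - ∫ y, k y * gaussDiff c y := by
      rw [← integral_neg_eq_self, ← integral_neg]
      simp [gaussDiff_neg]
    simp_rw [sub_mul]
    rw [integral_sub hkq hkq', this]; ring
  rw [e1, abs_mul, abs_of_pos (by norm_num : (0 : ℝ) < 1 / 2)]
  have i1 := (integrable_gaussDiff c).abs
  have i2 := integrable_abs_mul_gaussDiff hc
  have i3 := integrable_indicator_mul_gaussDiff hI c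
  have e2 : A * gaussMass c + B * c - h * gaussMassOn I c = 1 / 2 *
      ∫ y, (A * |gaussDiff c y| + B * (|y| * |gaussDiff c y|)
        - h * (I.indicator (fun _ => (1 : ℝ)) |y| * |gaussDiff c y|)) := by
    have i4 : Integrable (fun y => A * |gaussDiff c y| + B * (|y| * |gaussDiff c y|)) :=
      (i1.const_mul A).add (i2.const_mul B)
    rw [integral_sub i4 (i3.const_mul h), integral_add (i1.const_mul A) (i2.const_mul B),
      integral_const_mul, integral_const_mul,
      integral_const_mul, integral_abs_mul_gaussDiff hc, gaussMass, gaussMassOn]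
    ring
  rw [e2]
  gcongr
  refine (abs_integral_le_integral_abs).trans (integral_mono_ae ?_ ?_ ?_)
  · simpa [sub_mul] using (hkq.sub hkq').abs
  · exact ((i1.const_mul A).add (i2.const_mul B)).sub (i3.const_mul h)
  · have h0 : ∀ᵐ y : ℝ, y ≠ 0 := by simp [ae_iff]
    filter_upwards [h0] with y hy
    have : |k y - k (-y)| ≤ A + B * |y| - h * I.indicator (fun _ => (1 : ℝ)) |y| := by
      rcases lt_or_gt_of_ne hy with hy | hy
      · rw [abs_of_neg hy, abs_sub_comm]
        simpa using hosc (-y) (by linarith)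
      · rw [abs_of_pos hy]; exact hosc y hy
    calc |(k y - k (-y)) * gaussDiff c y| = |k y - k (-y)| * |gaussDiff c y| := abs_mul _ _
      _ ≤ (A + B * |y| - h * I.indicator (fun _ => (1 : ℝ)) |y|) * |gaussDiff c y| := by gcongr
      _ = _ := by ring

lemma integral_gaussianPDFReal_one (c : ℝ) : ∫ y, gaussianPDFReal c 1 y = 1 :=
  integral_gaussianPDFReal_eq_one c one_ne_zero

lemma gaussMass_le_one (c : ℝ) : gaussMass c ≤ 1 := by
  have : ∫ y, |gaussDiff c y| ≤ ∫ y, (gaussianPDFReal c 1 y + gaussianPDFReal (-c) 1 y) := by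
    refine integral_mono (integrable_gaussDiff c).abs
      ((integrable_gaussianPDFReal _ _).add (integrable_gaussianPDFReal _ _)) fun y => ?_
    have h1 := gaussianPDFReal_nonneg c 1 y
    have h2 := gaussianPDFReal_nonneg (-c) 1 y
    simp only [gaussDiff]
    rw [abs_le]; constructor <;> linarith
  rw [integral_add (integrable_gaussianPDFReal _ _) (integrable_gaussianPDFReal _ _),
    integral_gaussianPDFReal_one, integral_gaussianPDFReal_one] at this
  rw [gaussMass]; linarith

/-- From `1 - exp(-2cy) ≤ 2cy ≤ c(1 + y²)` and the second moment one gets `c(2 + c²)`, which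
suffices for `c ≤ 1`; beyond that the trivial bound 1 does. -/
lemma gaussMass_le_mul {c : ℝ} (hc : 0 ≤ c) : gaussMass c ≤ 4 * c := by
  have i1 : ∀ c : ℝ, Integrable (fun y : ℝ => y ^ 2) (gaussianReal c 1) := fun c =>
    (memLp_id_gaussianReal 2).integrable_sq
  have i2 : ∀ c : ℝ, Integrable (fun y : ℝ => (1 + y ^ 2) / 2) (gaussianReal c 1) := fun c =>
    ((integrable_const 1).add (i1 c)).div_const 2
  have e2 : ∀ c : ℝ, ∫ y, (1 + y ^ 2) / 2 ∂gaussianReal c 1 = (2 + c ^ 2) / 2 := by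
    intro c
    have hv : Var[id; gaussianReal c 1] = 1 := by simp
    rw [variance_eq_sub (memLp_id_gaussianReal 2)] at hv
    simp only [id, Pi.pow_apply, integral_id_gaussianReal] at hv
    rw [integral_div, integral_add (integrable_const 1) (i1 c)]
    simp only [integral_const, probReal_univ, smul_eq_mul, mul_one]
    linarith
  have key : ∫ y, |gaussDiff c y| ≤
      ∫ y, 2 * c * ((1 + y ^ 2) / 2 * gaussianPDFReal c 1 y
        + (1 + y ^ 2) / 2 * gaussianPDFReal (-c) 1 y) := by
    refine integral_mono (integrable_gaussDiff c).abs
      (((integrable_mul_gaussianPDFReal (i2 _)).add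
        (integrable_mul_gaussianPDFReal (i2 _))).const_mul _) ?_
    have pos : ∀ y, 0 ≤ y → |gaussDiff c y| ≤ 2 * c * ((1 + y ^ 2) / 2 * gaussianPDFReal c 1 y) := by
      intro y hy
      rw [abs_of_nonneg (gaussDiff_nonneg hc hy), gaussDiff_eq]
      have h1 := gaussianPDFReal_nonneg c 1 y
      have h2 : 1 - exp (-(2 * c * y)) ≤ 2 * c * y := by
        linarith [add_one_le_exp (-(2 * c * y))]
      have h3 : 2 * c * y ≤ 2 * c * ((1 + y ^ 2) / 2) := by
        gcongr; nlinarith [sq_nonneg (y - 1)]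
      calc _ ≤ gaussianPDFReal c 1 y * (2 * c * ((1 + y ^ 2) / 2)) := by gcongr; linarith
        _ = _ := by ring
    intro y
    have h1 := gaussianPDFReal_nonneg c 1 y
    have h2 := gaussianPDFReal_nonneg (-c) 1 y
    rcases le_total 0 y with hy | hy
    · refine (pos y hy).trans ?_
      have : 0 ≤ (1 + y ^ 2) / 2 * gaussianPDFReal (-c) 1 y := by positivity
      exact mul_le_mul_of_nonneg_left (by linarith) (by linarith)
    · have := pos (-y) (by linarith)
      rw [abs_gaussDiff_neg] at this
      refine this.trans ?_
      have e : gaussianPDFReal c 1 (-y) = gaussianPDFReal (-c) 1 y := by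
        simpa using gaussianPDFReal_neg_neg (-c) y
      rw [e, neg_sq]
      have : 0 ≤ (1 + y ^ 2) / 2 * gaussianPDFReal c 1 y := by positivity
      exact mul_le_mul_of_nonneg_left (by linarith) (by linarith)
  rw [integral_const_mul, integral_add (integrable_mul_gaussianPDFReal (i2 _))
    (integrable_mul_gaussianPDFReal (i2 _)), ← integral_gaussianReal_one,
    ← integral_gaussianReal_one, e2, e2] at key
  have h1 := gaussMass_le_one c
  rcases le_total c 1 with h | h
  · rw [gaussMass]
    nlinarith [mul_nonneg hc hc, mul_nonneg (mul_nonneg hc hc) (sub_nonneg.2 h),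
      mul_nonneg hc (sub_nonneg.2 h)]
  · linarith

lemma integral_indicator_Icc (a b h : ℝ) (hab : a ≤ b) :
    ∫ y, (Set.Icc a b).indicator (fun _ => h) y = h * (b - a) := by
  rw [integral_indicator measurableSet_Icc]
  simp [hab, mul_comm]

lemma integrable_indicator_Icc (a b h : ℝ) :
    Integrable ((Set.Icc a b).indicator (fun _ : ℝ => h)) := by
  rw [integrable_indicator_iff measurableSet_Icc]
  simp [integrableOn_const_iff]

/-- Both densities exceed a constant on `[-1, 1]`, where the distance to either centre is at most 3;
this common part cancels. -/
lemma gaussMass_le_one_sub {c : ℝ} (h0 : 0 ≤ c) (hc : c ≤ 2) :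
    gaussMass c ≤ 1 - 2 * ((√(2 * π))⁻¹ * exp (-9 / 2)) := by
  set p := (√(2 * π))⁻¹ * exp (-9 / 2) with hp
  have low : ∀ c' y : ℝ, |c'| ≤ 2 → y ∈ Set.Icc (-1 : ℝ) 1 → p ≤ gaussianPDFReal c' 1 y := by
    intro c' y hc' hy
    rw [gaussianPDFReal_one, hp]
    gcongr
    have := abs_le.1 hc'
    nlinarith [hy.1, hy.2]
  have : ∫ y, |gaussDiff c y| ≤ ∫ y, (gaussianPDFReal c 1 y + gaussianPDFReal (-c) 1 y
      - (Set.Icc (-1 : ℝ) 1).indicator (fun _ => 2 * p) y) := by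
    refine integral_mono (integrable_gaussDiff c).abs
      (((integrable_gaussianPDFReal _ _).add (integrable_gaussianPDFReal _ _)).sub
        (integrable_indicator_Icc _ _ _)) fun y => ?_
    have h1 := gaussianPDFReal_nonneg c 1 y
    have h2 := gaussianPDFReal_nonneg (-c) 1 y
    simp only [gaussDiff]
    by_cases hy : y ∈ Set.Icc (-1 : ℝ) 1
    · have := low c y (by rw [abs_of_nonneg h0]; exact hc) hy
      have := low (-c) y (by rw [abs_neg, abs_of_nonneg h0]; exact hc) hy
      rw [Set.indicator_of_mem hy, abs_le]; constructor <;> linarith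
    · rw [Set.indicator_of_notMem hy, abs_le]; constructor <;> linarith
  have i1 : Integrable (fun y => gaussianPDFReal c 1 y + gaussianPDFReal (-c) 1 y) :=
    (integrable_gaussianPDFReal _ _).add (integrable_gaussianPDFReal _ _)
  rw [integral_sub i1 (integrable_indicator_Icc _ _ _),
    integral_add (integrable_gaussianPDFReal _ _) (integrable_gaussianPDFReal _ _),
    integral_gaussianPDFReal_one, integral_gaussianPDFReal_one,
    integral_indicator_Icc _ _ _ (by norm_num)] at this
  rw [gaussMass]; linarith

/-- On this window the density centred at `c` is bounded below and the other is at most half of it.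
The window stays half a unit below `c`, so that the concave potential lies strictly under its
tangent there. -/
lemma le_gaussMassOn {c : ℝ} (hc : 2 ≤ c) :
    1 / 8 * ((√(2 * π))⁻¹ * exp (-1 / 2)) ≤ gaussMassOn (Set.Icc (c - 1) (c - 1 / 2)) c := by
  set p := (√(2 * π))⁻¹ * exp (-1 / 2) with hp
  have hp0 : 0 < p := by positivity
  have : ∫ y, (Set.Icc (c - 1) (c - 1 / 2)).indicator (fun _ => p / 2) y ≤
      ∫ y, (Set.Icc (c - 1) (c - 1 / 2)).indicator (fun _ => (1 : ℝ)) |y| * |gaussDiff c y| := by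
    refine integral_mono (integrable_indicator_Icc _ _ _)
      (integrable_indicator_mul_gaussDiff measurableSet_Icc c) fun y => ?_
    by_cases hy : y ∈ Set.Icc (c - 1) (c - 1 / 2)
    · have hy0 : 1 ≤ y := by linarith [hy.1]
      simp only [abs_of_nonneg (by linarith : 0 ≤ y)]
      rw [Set.indicator_of_mem hy, Set.indicator_of_mem hy, one_mul]
      refine le_trans ?_ (le_abs_self _)
      rw [gaussDiff_eq]
      have h1 : p ≤ gaussianPDFReal c 1 y := by
        rw [gaussianPDFReal_one, hp]
        gcongr
        nlinarith [hy.1, hy.2]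
      have h2 : exp (-(2 * c * y)) ≤ 1 / 2 := by
        have e1 : exp (-(2 * c * y)) ≤ exp (-1) := exp_le_exp.2 (by nlinarith)
        have e2 : exp (-1) ≤ 1 / 2 := by
          rw [exp_neg, inv_le_comm₀ (exp_pos _) (by norm_num)]
          have := add_one_le_exp (1 : ℝ)
          norm_num at this ⊢; exact this
        linarith
      nlinarith
    · simp only [Set.indicator_of_notMem hy]
      have : 0 ≤ (Set.Icc (c - 1) (c - 1 / 2)).indicator (fun _ => (1 : ℝ)) |y| :=
        Set.indicator_nonneg (fun _ _ => zero_le_one) _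
      positivity
  rw [integral_indicator_Icc _ _ _ (by linarith)] at this
  rw [gaussMassOn]; linarith

lemma exists_gauss_gain : ∃ g : ℝ, 0 < g ∧
    (∀ c, 0 ≤ c → c ≤ 2 → gaussMass c ≤ 1 - g) ∧
    ∀ c, 2 ≤ c → g ≤ gaussMassOn (Set.Icc (c - 1) (c - 1 / 2)) c := by
  obtain ⟨a, ha⟩ : ∃ a, a = 2 * ((√(2 * π))⁻¹ * exp (-9 / 2)) := ⟨_, rfl⟩
  obtain ⟨b, hb⟩ : ∃ b, b = 1 / 8 * ((√(2 * π))⁻¹ * exp (-1 / 2)) := ⟨_, rfl⟩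
  have ha0 : 0 < a := by rw [ha]; positivity
  have hb0 : 0 < b := by rw [hb]; positivity
  refine ⟨min a b, lt_min ha0 hb0, fun c h0 h2 => ?_, fun c h2 => ?_⟩
  · have := gaussMass_le_one_sub h0 h2
    rw [← ha] at this
    linarith [min_le_left a b]
  · have := le_gaussMassOn h2
    rw [← hb] at this
    exact (min_le_right a b).trans this

end PnPULA

/-! ### Reflection bound for isotropic Gaussians in a Euclidean space. -/

namespace PnPULA
open MeasureTheory ProbabilityTheory Real

variable {E : Type*} [NormedAddCommGroup E] [InnerProductSpace ℝ E] [FiniteDimensional ℝ E]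
  [MeasurableSpace E] [BorelSpace E]

/-- Resampling the component of a standard Gaussian vector along a unit vector does not change its
law. -/
lemma map_resample_stdGaussian {e : E} (he : ‖e‖ = 1) :
    ((stdGaussian E).prod (gaussianReal 0 1)).map
      (fun p : E × ℝ => (p.1 - inner ℝ e p.1 • e) + p.2 • e) = stdGaussian E := by
  have hm : Measurable (fun p : E × ℝ => (p.1 - inner ℝ e p.1 • e) + p.2 • e) := by fun_prop
  have : IsProbabilityMeasure (((stdGaussian E).prod (gaussianReal 0 1)).map
      (fun p : E × ℝ => (p.1 - inner ℝ e p.1 • e) + p.2 • e)) :=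
    Measure.isProbabilityMeasure_map hm.aemeasurable
  refine Measure.ext_of_charFun (funext fun t => ?_)
  rw [charFun_apply, integral_map hm.aemeasurable (by fun_prop)]
  have h1 : ∀ p : E × ℝ, Complex.exp (inner ℝ ((p.1 - inner ℝ e p.1 • e) + p.2 • e) t * Complex.I)
      = Complex.exp (inner ℝ p.1 (t - inner ℝ e t • e) * Complex.I) *
        Complex.exp (inner ℝ p.2 (inner ℝ e t) * Complex.I) := by
    intro p
    rw [← Complex.exp_add, ← add_mul, ← Complex.ofReal_add]
    congr 3
    simp only [inner_add_left, inner_sub_left, inner_sub_right, real_inner_smul_left,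
      real_inner_smul_right, real_inner_comm e p.1]
    simp [mul_comm]
  simp_rw [h1]
  rw [integral_prod_mul (fun x : E => Complex.exp (inner ℝ x (t - inner ℝ e t • e) * Complex.I))
    (fun x : ℝ => Complex.exp (inner ℝ x (inner ℝ e t) * Complex.I)), ← charFun_apply,
    ← charFun_apply, charFun_stdGaussian, charFun_stdGaussian, charFun_gaussianReal,
    ← Complex.exp_add]
  congr 1
  have h2 : ‖t - inner ℝ e t • e‖ ^ 2 = ‖t‖ ^ 2 - (inner ℝ e t) ^ 2 := by
    rw [norm_sub_sq_real, norm_smul, he, real_inner_smul_right, real_inner_comm e t]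
    simp; ring
  have h3 : ((‖t - inner ℝ e t • e‖ : ℂ)) ^ 2 = (‖t‖ : ℂ) ^ 2 - ((inner ℝ e t : ℝ) : ℂ) ^ 2 := by
    exact_mod_cast h2
  rw [h3]; push_cast; ring

lemma integral_stdGaussian_resample {e : E} (he : ‖e‖ = 1) {g : E → ℝ} (hg : Measurable g) {M : ℝ}
    (hM : ∀ x, |g x| ≤ M) :
    ∫ z, g z ∂stdGaussian E =
      ∫ z, ∫ x, g ((z - inner ℝ e z • e) + x • e) ∂gaussianReal 0 1 ∂stdGaussian E := by
  have hm : Measurable (fun p : E × ℝ => (p.1 - inner ℝ e p.1 • e) + p.2 • e) := by fun_prop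
  conv_lhs => rw [← map_resample_stdGaussian he]
  rw [integral_map hm.aemeasurable hg.aestronglyMeasurable, integral_prod]
  exact Integrable.of_bound (hg.comp hm).aestronglyMeasurable M
    (Filter.Eventually.of_forall fun _ => hM _)

lemma integral_comp_add_gaussianReal (c : ℝ) {k : ℝ → ℝ} (hk : Measurable k) :
    ∫ x, k (x + c) ∂gaussianReal 0 1 = ∫ x, k x ∂gaussianReal c 1 := by
  have := gaussianReal_map_add_const (μ := 0) (v := 1) c
  rw [zero_add] at this
  rw [← this, integral_map (by fun_prop) hk.aestronglyMeasurable]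

/-- The reflection bound for two Gaussian laws with covariance `s² I` centred at `a` and `b`. -/
lemma abs_integral_stdGaussian_sub_le {g : E → ℝ} (hg : Measurable g) {M : ℝ}
    (hM : ∀ x, |g x| ≤ M) {Φ : ℝ → ℝ} (hΦ : ∀ u v, u ≠ v → |g u - g v| ≤ Φ ‖u - v‖)
    {s : ℝ} (hs : 0 < s) {a b : E} (hab : a ≠ b) {A B h : ℝ} {I : Set ℝ} (hI : MeasurableSet I)
    (hAB : ∀ t, 0 < t → Φ (2 * s * t) ≤ A + B * (2 * s * t) - h * I.indicator (fun _ => (1 : ℝ)) t) :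
    |∫ z, g (a + s • z) ∂stdGaussian E - ∫ z, g (b + s • z) ∂stdGaussian E| ≤
      A * gaussMass (‖a - b‖ / (2 * s)) + B * ‖a - b‖ - h * gaussMassOn I (‖a - b‖ / (2 * s)) := by
  set r := ‖a - b‖ with hr
  have hr0 : 0 < r := norm_pos_iff.2 (sub_ne_zero.2 hab)
  set c := r / (2 * s) with hc
  have hc0 : 0 ≤ c := by positivity
  set e : E := r⁻¹ • (a - b) with he'
  have he : ‖e‖ = 1 := by
    rw [he', norm_smul, norm_inv, Real.norm_of_nonneg hr0.le, ← hr, inv_mul_cancel₀ hr0.ne']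
  have hsc : s * c = r / 2 := by rw [hc]; field_simp
  have hre : r • e = a - b := by rw [he', smul_smul, mul_inv_cancel₀ hr0.ne', one_smul]
  set w : E → E := fun z => z - inner ℝ e z • e with hw
  -- With the component orthogonal to `e` frozen and the origin at the midpoint of `a` and `b`, the
  -- two laws become unit Gaussians centred at `c` and `-c`.
  set k : E → ℝ → ℝ := fun z x => g ((2⁻¹ : ℝ) • (a + b) + s • w z + (s * x) • e) with hk
  have hkm : ∀ z, Measurable (k z) := fun z => hg.comp (by fun_prop)
  have ha : (2⁻¹ : ℝ) • (a + b) + (s * c) • e = a := by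
    rw [hsc, div_eq_inv_mul, mul_smul, hre, ← smul_add]
    rw [add_add_sub_cancel, ← two_smul ℝ a, smul_smul]; norm_num
  have hb : (2⁻¹ : ℝ) • (a + b) - (s * c) • e = b := by
    rw [hsc, div_eq_inv_mul, mul_smul, hre, ← smul_sub, add_sub_sub_cancel, ← two_smul ℝ b,
      smul_smul]; norm_num
  have e1 : ∫ z, g (a + s • z) ∂stdGaussian E
      = ∫ z, ∫ x, k z x ∂gaussianReal c 1 ∂stdGaussian E := by
    rw [integral_stdGaussian_resample he (g := fun z => g (a + s • z))
      (hg.comp (by fun_prop)) (fun x => hM _)]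
    refine integral_congr_ae (Filter.Eventually.of_forall fun z => ?_)
    simp only
    rw [← integral_comp_add_gaussianReal c (hkm z)]
    refine integral_congr_ae (Filter.Eventually.of_forall fun x => ?_)
    simp only [hk]
    congr 1
    conv_lhs => rw [← ha]
    simp only [hw]; module
  have e2 : ∫ z, g (b + s • z) ∂stdGaussian E
      = ∫ z, ∫ x, k z x ∂gaussianReal (-c) 1 ∂stdGaussian E := by
    rw [integral_stdGaussian_resample he (g := fun z => g (b + s • z))
      (hg.comp (by fun_prop)) (fun x => hM _)]
    refine integral_congr_ae (Filter.Eventually.of_forall fun z => ?_)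
    simp only
    rw [← integral_comp_add_gaussianReal (-c) (hkm z)]
    refine integral_congr_ae (Filter.Eventually.of_forall fun x => ?_)
    simp only [hk]
    congr 1
    conv_lhs => rw [← hb]
    simp only [hw]; module
  have key : ∀ z, |∫ x, k z x ∂gaussianReal c 1 - ∫ x, k z x ∂gaussianReal (-c) 1| ≤
      A * gaussMass c + B * r - h * gaussMassOn I c := by
    intro z
    -- Mirror points at coordinates `±y` lie `2 * s * y` apart, hence the rescaled slope.
    have := abs_integral_gaussianReal_sub_le (A := A) (B := B * (2 * s)) (h := h) hc0 hI (hkm z)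
      (fun _ => hM _) (fun y hy => ?_)
    · refine this.trans (le_of_eq ?_)
      rw [mul_assoc B, mul_assoc 2, hsc]; ring
    · have hdiff : ((2⁻¹ : ℝ) • (a + b) + s • w z + (s * y) • e) -
          ((2⁻¹ : ℝ) • (a + b) + s • w z + (s * -y) • e) = (2 * s * y) • e := by module
      have hn : ‖(2 * s * y) • e‖ = 2 * s * y := by
        rw [norm_smul, he, mul_one, Real.norm_of_nonneg (by positivity)]
      refine (hΦ _ _ fun heq => ?_).trans ?_
      · rw [← sub_eq_zero, hdiff] at heq
        rw [heq, norm_zero] at hn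
        have : 0 < 2 * s * y := by positivity
        linarith
      · rw [hdiff, hn, mul_assoc B]; exact hAB y hy
  have hint : ∀ c : ℝ, Integrable (fun z => ∫ x, k z x ∂gaussianReal c 1) (stdGaussian E) := by
    intro c
    refine Integrable.of_bound (C := M) ?_ (Filter.Eventually.of_forall fun z => ?_)
    · have : Measurable (fun p : E × ℝ => k p.1 p.2) := hg.comp (by fun_prop)
      exact this.stronglyMeasurable.integral_prod_right.aestronglyMeasurable
    · refine (norm_integral_le_of_norm_le_const (C := M)
        (Filter.Eventually.of_forall fun x => hM _)).trans (by simp)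
  rw [e1, e2, ← integral_sub (hint _) (hint _)]
  simpa using norm_integral_le_of_norm_le_const (μ := stdGaussian E)
    (f := fun z => ∫ x, k z x ∂gaussianReal c 1 - ∫ x, k z x ∂gaussianReal (-c) 1)
    (Filter.Eventually.of_forall key)

end PnPULA

/-! ### The concave potential and its decrease under one Gaussian step. -/

namespace PnPULA
open MeasureTheory ProbabilityTheory Real

/-- The concave distance function, with a jump `J` at the origin, that controls the oscillation of
the partial sums `∑ Rⁱ f`. -/
def potential (J C κ δ t : ℝ) : ℝ := J + (t + C * (1 - exp (-(κ * t)))) / δ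

lemma exp_neg_tangent_le (κ ρ t : ℝ) :
    exp (-(κ * ρ)) * (1 - κ * (t - ρ)) ≤ exp (-(κ * t)) := by
  have h := add_one_le_exp (-(κ * (t - ρ)))
  have e : exp (-(κ * t)) = exp (-(κ * ρ)) * exp (-(κ * (t - ρ))) := by
    rw [← exp_add]; ring_nf
  rw [e]
  exact mul_le_mul_of_nonneg_left (by linarith) (exp_pos _).le

lemma exp_neg_quadratic_le {κ ρ t : ℝ} (hκ : 0 ≤ κ) (ht : t ≤ ρ) :
    exp (-(κ * ρ)) * (1 - κ * (t - ρ) + κ ^ 2 * (t - ρ) ^ 2 / 2) ≤ exp (-(κ * t)) := by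
  have h := quadratic_le_exp_of_nonneg (x := κ * (ρ - t)) (mul_nonneg hκ (by linarith))
  have e : exp (-(κ * t)) = exp (-(κ * ρ)) * exp (κ * (ρ - t)) := by
    rw [← exp_add]; ring_nf
  rw [e]
  exact mul_le_mul_of_nonneg_left (by nlinarith) (exp_pos _).le

lemma potential_le_tangent {J C κ δ : ℝ} (hC : 0 ≤ C) (hδ : 0 < δ) (ρ t : ℝ) :
    potential J C κ δ t ≤ (J + C * (1 - exp (-(κ * ρ)) * (1 + κ * ρ)) / δ) +
      (1 + C * κ * exp (-(κ * ρ))) / δ * t := by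
  have h := mul_le_mul_of_nonneg_left (exp_neg_tangent_le κ ρ t) hC
  rw [potential, add_assoc, div_mul_eq_mul_div, ← add_div]
  refine add_le_add le_rfl (div_le_div_of_nonneg_right ?_ hδ.le)
  linarith

/-- The quantitative form of concavity: left of the contact point the gap to the tangent is
quadratic. -/
lemma potential_le_tangent_sub {J C κ δ : ℝ} (hC : 0 ≤ C) (hκ : 0 ≤ κ) (hδ : 0 < δ) {ρ t : ℝ}
    (ht : t ≤ ρ) :
    potential J C κ δ t ≤ (J + C * (1 - exp (-(κ * ρ)) * (1 + κ * ρ)) / δ) +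
      (1 + C * κ * exp (-(κ * ρ))) / δ * t - C * exp (-(κ * ρ)) * κ ^ 2 * (t - ρ) ^ 2 / 2 / δ := by
  have h := mul_le_mul_of_nonneg_left (exp_neg_quadratic_le hκ ht) hC
  rw [potential, add_assoc, div_mul_eq_mul_div, ← add_div, add_sub_assoc, ← sub_div]
  refine add_le_add le_rfl (div_le_div_of_nonneg_right ?_ hδ.le)
  linarith

lemma potential_eq_tangent (J C κ δ ρ : ℝ) :
    potential J C κ δ ρ = (J + C * (1 - exp (-(κ * ρ)) * (1 + κ * ρ)) / δ) +
      (1 + C * κ * exp (-(κ * ρ))) / δ * ρ := by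
  rw [potential]; ring

variable {E : Type*} [NormedAddCommGroup E] [InnerProductSpace ℝ E] [FiniteDimensional ℝ E]
  [MeasurableSpace E] [BorelSpace E]

lemma abs_integral_stdGaussian_sub_le_mul {g : E → ℝ} (hg : Measurable g) {M : ℝ}
    (hM : ∀ x, |g x| ≤ M) {J C κ δ : ℝ} (hJ : 0 ≤ J) (hC : 0 ≤ C) (hδ : 0 < δ)
    (hδ1 : δ ≤ 1) (hΦ : ∀ u v, u ≠ v → |g u - g v| ≤ potential J C κ δ ‖u - v‖) (x v w : E) :
    |∫ z, g (x + δ • v + √(2 * δ) • z) ∂stdGaussian E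
      - ∫ z, g (x + δ • w + √(2 * δ) • z) ∂stdGaussian E| ≤
      (2 * J + (1 + C * κ)) * ‖v - w‖ := by
  rcases eq_or_ne v w with rfl | hvw
  · simp
  have hab : x + δ • v ≠ x + δ • w := by
    intro h
    exact hvw (smul_right_injective E hδ.ne' (add_left_cancel h))
  have hs : 0 < √(2 * δ) := by positivity
  have hn : ‖(x + δ • v) - (x + δ • w)‖ = δ * ‖v - w‖ := by
    rw [add_sub_add_left_eq_sub, ← smul_sub, norm_smul, Real.norm_of_nonneg hδ.le]
  -- The tangent at 0 has intercept `J`.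
  have key := abs_integral_stdGaussian_sub_le (h := 0) (A := J) (B := (1 + C * κ) / δ)
    hg hM hΦ hs hab MeasurableSet.univ (fun t _ => by
      have := potential_le_tangent (J := J) (κ := κ) hC hδ 0 (2 * √(2 * δ) * t)
      simpa using this)
  rw [hn] at key
  refine key.trans ?_
  have hmass := gaussMass_le_mul (c := δ * ‖v - w‖ / (2 * √(2 * δ))) (by positivity)
  have h1 : δ ≤ √(2 * δ) := by
    refine Real.le_sqrt_of_sq_le ?_
    nlinarith
  have h2 : 4 * (δ * ‖v - w‖ / (2 * √(2 * δ))) ≤ 2 * ‖v - w‖ := by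
    rw [mul_div_assoc', div_le_iff₀ (by positivity)]
    nlinarith [mul_le_mul_of_nonneg_right h1 (norm_nonneg (v - w))]
  have h3 : (1 + C * κ) / δ * (δ * ‖v - w‖) = (1 + C * κ) * ‖v - w‖ := by
    field_simp
  have h4 := mul_le_mul_of_nonneg_left (hmass.trans h2) hJ
  rw [h3]
  linarith

/-- Replacing the potential by its tangent at `ρ = ‖a - b‖` leaves `A * gaussMass + B * ρ`, at most
its value at `ρ`. Three regimes then supply the missing 2 and absorb the possible expansion of `r`
to `ρ`. -/
lemma abs_integral_stdGaussian_sub_le_potential {β α γ κ C J R δ : ℝ} (hβ : 0 ≤ β) (hα : 0 < α)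
    (hγ : 0 < γ) (hmass : ∀ c, 0 ≤ c → c ≤ 2 → gaussMass c ≤ 1 - γ)
    (hmassOn : ∀ c, 2 ≤ c → γ ≤ gaussMassOn (Set.Icc (c - 1) (c - 1 / 2)) c)
    (hRα : α * R = β + 2) (hκpos : 0 < κ) (hκγ : γ * κ = 3 * β + 1) (hCpos : 0 < C)
    (hCκ : C * κ = (2 + β) * exp (κ * (R + 1))) (hJ2 : 2 ≤ J)
    (hJγ : 2 + (1 + C * κ) * β ≤ J * γ) (hδ : 0 < δ) (hδβ : δ * β ≤ 1) (hκδβ : κ * (δ * β) ≤ 1)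
    {g : E → ℝ} (hg : Measurable g) {M : ℝ} (hM : ∀ x, |g x| ≤ M)
    (hΦ : ∀ u v, u ≠ v → |g u - g v| ≤ potential J C κ δ ‖u - v‖)
    {a b : E} {r : ℝ} (hr : 0 < r) (hab : ‖a - b‖ ≤ r + δ * (β - α * r)) :
    |∫ z, g (a + √(2 * δ) • z) ∂stdGaussian E
      - ∫ z, g (b + √(2 * δ) • z) ∂stdGaussian E| ≤ potential J C κ δ r - 2 := by
  have hpot_J : J ≤ potential J C κ δ r := by
    rw [potential]
    have : exp (-(κ * r)) ≤ 1 := exp_le_one_iff.2 (by linarith [mul_pos hκpos hr])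
    have : 0 ≤ (r + C * (1 - exp (-(κ * r)))) / δ :=
      div_nonneg (add_nonneg hr.le (mul_nonneg hCpos.le (by linarith))) hδ.le
    linarith
  rcases eq_or_ne a b with rfl | hne
  · simp only [sub_self, abs_zero]; linarith
  obtain ⟨ρ, hρ⟩ : ∃ ρ, ρ = ‖a - b‖ := ⟨_, rfl⟩
  rw [← hρ] at hab
  have hρ0 : 0 < ρ := hρ ▸ norm_pos_iff.2 (sub_ne_zero.2 hne)
  obtain ⟨s, hs'⟩ : ∃ s, s = √(2 * δ) := ⟨_, rfl⟩
  rw [← hs']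
  have hs : 0 < s := by rw [hs']; positivity
  have hs2 : s ^ 2 = 2 * δ := hs' ▸ Real.sq_sqrt (by positivity)
  obtain ⟨X, hX⟩ : ∃ X, X = exp (-(κ * ρ)) := ⟨_, rfl⟩
  have hX0 : 0 < X := hX ▸ exp_pos _
  have hX1 : X * (1 + κ * ρ) ≤ 1 := by
    have := exp_neg_tangent_le κ ρ 0
    rw [← hX] at this
    simpa [mul_comm] using this
  obtain ⟨A, hA⟩ : ∃ A, A = J + C * (1 - X * (1 + κ * ρ)) / δ := ⟨_, rfl⟩
  obtain ⟨B, hB⟩ : ∃ B, B = (1 + C * κ * X) / δ := ⟨_, rfl⟩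
  have hAJ : J ≤ A := by
    have : 0 ≤ C * (1 - X * (1 + κ * ρ)) / δ :=
      div_nonneg (mul_nonneg hCpos.le (by linarith)) hδ.le
    linarith
  have htan : potential J C κ δ ρ = A + B * ρ := by
    rw [hA, hB, hX]; exact potential_eq_tangent J C κ δ ρ
  have htan_le : ∀ t, potential J C κ δ t ≤ A + B * t := by
    rw [hA, hB, hX]; exact potential_le_tangent hCpos.le hδ ρ
  have hplain := abs_integral_stdGaussian_sub_le (h := 0) (A := A) (B := B) hg hM hΦ hs hne
    (I := Set.univ) MeasurableSet.univ (fun t _ => by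
      simpa using htan_le (2 * s * t))
  rw [← hρ, zero_mul, sub_zero] at hplain
  have hA0 : 0 ≤ A := by linarith
  -- For `r ≥ R` the drift shortens the distance by `2 * δ`, and the term `t / δ` alone falls by 2.
  rcases le_or_gt R r with hRr | hrR
  · have h1 := mul_le_mul_of_nonneg_left (gaussMass_le_one (ρ / (2 * s))) hA0
    have h2 : δ * (β - α * r) ≤ δ * (-2) := by
      refine mul_le_mul_of_nonneg_left ?_ hδ.le
      linarith [mul_le_mul_of_nonneg_left hRr hα.le]
    have h3 : potential J C κ δ ρ ≤ potential J C κ δ r - 2 := by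
      have hρr : ρ ≤ r := by linarith
      have e : exp (-(κ * r)) ≤ exp (-(κ * ρ)) :=
        exp_le_exp.2 (neg_le_neg (mul_le_mul_of_nonneg_left hρr hκpos.le))
      have e' := mul_le_mul_of_nonneg_left e hCpos.le
      rw [potential, potential, add_sub_assoc, add_le_add_iff_left, div_le_iff₀ hδ, sub_mul,
        div_mul_cancel₀ _ hδ.ne']
      linarith
    linarith
  have hρr : ρ - r ≤ δ * β := by
    have : 0 ≤ δ * (α * r) := by positivity
    linarith
  have hgrow : potential J C κ δ ρ ≤ potential J C κ δ r + (1 + C * κ * exp (-(κ * r))) * β := by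
    have h := potential_le_tangent (J := J) (κ := κ) hCpos.le hδ r ρ
    have e := potential_eq_tangent J C κ δ r
    have h4 : (1 + C * κ * exp (-(κ * r))) / δ * (ρ - r) ≤
        (1 + C * κ * exp (-(κ * r))) / δ * (δ * β) := by gcongr
    have h5 : (1 + C * κ * exp (-(κ * r))) / δ * (δ * β) =
        (1 + C * κ * exp (-(κ * r))) * β := by field_simp
    linarith
  -- If the centres are close compared with the noise, the overlap saves `γ * A ≥ γ * J`. Otherwise
  -- concavity saves `γ * (C * κ ^ 2 * X)`.
  rcases le_or_gt (ρ / (2 * s)) 2 with hc | hc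
  · have h1 := hmass _ (by positivity) hc
    have h2 := mul_le_mul_of_nonneg_left h1 hA0
    have h3 := mul_le_mul_of_nonneg_right hAJ hγ.le
    have h4 : (1 + C * κ * exp (-(κ * r))) * β ≤ (1 + C * κ) * β := by
      have : exp (-(κ * r)) ≤ 1 := exp_le_one_iff.2 (by linarith [mul_pos hκpos hr])
      refine mul_le_mul_of_nonneg_right (add_le_add le_rfl ?_) hβ
      exact mul_le_of_le_one_right (by positivity) this
    linarith
  · have hI := abs_integral_stdGaussian_sub_le (h := C * κ ^ 2 * X) (A := A) (B := B) hg hM hΦ hs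
      hne (I := Set.Icc (ρ / (2 * s) - 1) (ρ / (2 * s) - 1 / 2)) measurableSet_Icc (fun t _ => by
        by_cases ht : t ∈ Set.Icc (ρ / (2 * s) - 1) (ρ / (2 * s) - 1 / 2)
        · rw [Set.indicator_of_mem ht, mul_one]
          have h1 : 2 * s * t ≤ ρ - s := by
            have := mul_le_mul_of_nonneg_left ht.2 (by positivity : 0 ≤ 2 * s)
            have e : 2 * s * (ρ / (2 * s) - 1 / 2) = ρ - s := by field_simp
            linarith
          have h2 := potential_le_tangent_sub (J := J) hCpos.le hκpos.le hδ
            (by linarith : 2 * s * t ≤ ρ)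
          rw [← hX, ← hA, ← hB] at h2
          refine h2.trans ?_
          -- The gap is of order `s ^ 2 = 2 * δ`, which cancels the `1 / δ` in the potential.
          have h3 : 2 * δ ≤ (2 * s * t - ρ) ^ 2 := by
            rw [← hs2, ← neg_sq (2 * s * t - ρ)]
            exact pow_le_pow_left₀ hs.le (by linarith) 2
          have h4 : C * κ ^ 2 * X ≤ C * X * κ ^ 2 * (2 * s * t - ρ) ^ 2 / 2 / δ := by
            rw [le_div_iff₀ hδ]
            have h5 : 0 ≤ C * X * κ ^ 2 := by positivity
            linarith [mul_le_mul_of_nonneg_left h3 h5]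
          linarith
        · rw [Set.indicator_of_notMem ht, mul_zero, sub_zero]
          exact htan_le (2 * s * t))
    rw [← hρ] at hI
    have h1 := mul_le_mul_of_nonneg_left (gaussMass_le_one (ρ / (2 * s))) hA0
    have h2 := mul_le_mul_of_nonneg_left (hmassOn _ hc.le)
      (by positivity : 0 ≤ C * κ ^ 2 * X)
    have h3 : exp (-(κ * r)) ≤ 3 * X := by
      have e : exp (-(κ * r)) = X * exp (κ * (ρ - r)) := by
        rw [hX, ← exp_add]; ring_nf
      have h4 : exp (κ * (ρ - r)) ≤ exp 1 :=
        exp_le_exp.2 ((mul_le_mul_of_nonneg_left hρr hκpos.le).trans hκδβ)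
      have h5 : exp (1 : ℝ) ≤ 3 := by linarith [exp_one_lt_d9]
      rw [e, mul_comm 3]
      exact mul_le_mul_of_nonneg_left (h4.trans h5) hX0.le
    have h4 : 2 + β ≤ C * κ * X := by
      have h6 : exp (-(κ * (R + 1))) ≤ X := by
        rw [hX]
        refine exp_le_exp.2 (neg_le_neg (mul_le_mul_of_nonneg_left ?_ hκpos.le))
        linarith
      have h7 : exp (κ * (R + 1)) * exp (-(κ * (R + 1))) = 1 := by
        rw [← exp_add, add_neg_cancel, exp_zero]
      have h8 : 1 ≤ exp (κ * (R + 1)) * X := by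
        exact h7.symm.le.trans (mul_le_mul_of_nonneg_left h6 (exp_pos _).le)
      rw [hCκ, mul_assoc]
      exact le_mul_of_one_le_right (by linarith) h8
    have h5 : C * κ ^ 2 * X * γ = C * κ * X * (3 * β + 1) := by rw [← hκγ]; ring
    have h6 : C * κ * exp (-(κ * r)) * β ≤ C * κ * (3 * X) * β := by gcongr
    linarith

variable (E) in
/-- Drift condition: one Gaussian step decreases the potential by at least `2`. -/
lemma exists_potential {β α : ℝ} (hβ : 0 ≤ β) (hα : 0 < α) :
    ∃ J C κ δ₀ : ℝ, 0 < J ∧ 0 < C ∧ 0 < κ ∧ 0 < δ₀ ∧ δ₀ ≤ 1 ∧ ∀ δ, 0 < δ → δ ≤ δ₀ →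
      ∀ g : E → ℝ, Measurable g → (∃ M : ℝ, ∀ x, |g x| ≤ M) →
        (∀ u v, u ≠ v → |g u - g v| ≤ potential J C κ δ ‖u - v‖) →
        ∀ (a b : E) (r : ℝ), 0 < r → ‖a - b‖ ≤ r + δ * (β - α * r) →
          |∫ z, g (a + √(2 * δ) • z) ∂stdGaussian E
            - ∫ z, g (b + √(2 * δ) • z) ∂stdGaussian E| ≤ potential J C κ δ r - 2 := by
  obtain ⟨γ, hγ, hmass, hmassOn⟩ := exists_gauss_gain
  -- Each constant settles one regime. Past `R` the drift wins. The choice of `κ` makes the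
  -- concavity gain `C * κ * X * (3 * β + 1)` exceed the growth `β + 3 * C * κ * X * β` by `C * κ *
  -- X - β`, and `C` makes this at least 2 up to distance `R + 1`. Last, `J` makes the overlap gain
  -- cover the growth at short range.
  obtain ⟨R, hR⟩ : ∃ R, R = (β + 2) / α := ⟨_, rfl⟩
  have hRpos : 0 < R := by rw [hR]; positivity
  have hRα : α * R = β + 2 := by rw [hR]; field_simp
  obtain ⟨κ, hκ⟩ : ∃ κ, κ = (3 * β + 1) / γ := ⟨_, rfl⟩
  have hκpos : 0 < κ := by rw [hκ]; positivity
  have hκγ : γ * κ = 3 * β + 1 := by rw [hκ]; field_simp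
  obtain ⟨C, hC⟩ : ∃ C, C = (2 + β) * exp (κ * (R + 1)) / κ := ⟨_, rfl⟩
  have hCpos : 0 < C := by rw [hC]; positivity
  have hCκ : C * κ = (2 + β) * exp (κ * (R + 1)) := by rw [hC]; field_simp
  obtain ⟨J, hJ⟩ : ∃ J, J = 2 + (2 + (1 + C * κ) * β) / γ := ⟨_, rfl⟩
  have hJ2 : 2 ≤ J := by
    rw [hJ]
    have : 0 ≤ (2 + (1 + C * κ) * β) / γ := by positivity
    linarith
  have hJγ : 2 + (1 + C * κ) * β ≤ J * γ := by
    rw [hJ, add_mul 2, div_mul_cancel₀ _ hγ.ne']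
    linarith
  refine ⟨J, C, κ, 1 / ((κ + 1) * (β + 1)), by linarith, hCpos, hκpos, by positivity, ?_, ?_⟩
  · rw [div_le_one (by positivity)]
    nlinarith [mul_nonneg hκpos.le hβ]
  intro δ hδ hδ₀ g hg ⟨M, hM⟩ hΦ a b r hr hab
  rw [le_div_iff₀ (by positivity)] at hδ₀
  have hκβ : 0 ≤ κ * β := by positivity
  have hδβ : δ * β ≤ 1 :=
    (mul_le_mul_of_nonneg_left (by linarith : β ≤ (κ + 1) * (β + 1)) hδ.le).trans hδ₀
  have hκδβ : κ * (δ * β) ≤ 1 := by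
    rw [mul_left_comm]
    exact (mul_le_mul_of_nonneg_left (by linarith : κ * β ≤ (κ + 1) * (β + 1)) hδ.le).trans hδ₀
  exact abs_integral_stdGaussian_sub_le_potential hβ hα hγ hmass hmassOn hRα hκpos hκγ hCpos hCκ
    hJ2 hJγ hδ hδβ hκδβ hg hM hΦ hr hab

end PnPULA

/-! ### The Markov operator and the Poisson equation argument. -/

namespace PnPULA
open MeasureTheory ProbabilityTheory

/-- The bound `M` serves integrability only and does not enter the result; applied to the partial
sums, whose sup bound grows with `n`, it gives an estimate free of `n`. -/
lemma abs_integral_sub_le_of_osc {E : Type*} [NormedAddCommGroup E] [MeasurableSpace E]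
    {μ ν : Measure E} [IsProbabilityMeasure μ]
    [IsProbabilityMeasure ν] (hμ : Integrable (fun x => ‖x‖) μ) (hν : Integrable (fun x => ‖x‖) ν)
    {g : E → ℝ} (hg : Measurable g) {M : ℝ} (hM : ∀ x, |g x| ≤ M) {p q : ℝ}
    (hosc : ∀ u v, |g u - g v| ≤ p + q * (‖u‖ + ‖v‖)) :
    |∫ x, g x ∂μ - ∫ x, g x ∂ν| ≤ p + q * (∫ x, ‖x‖ ∂μ + ∫ x, ‖x‖ ∂ν) := by
  have hgi : ∀ (ρ : Measure E) [IsProbabilityMeasure ρ], Integrable g ρ := fun ρ _ =>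
    Integrable.of_bound hg.aestronglyMeasurable M (Filter.Eventually.of_forall hM)
  have h1 : ∀ u, |g u - ∫ x, g x ∂ν| ≤ p + q * (‖u‖ + ∫ x, ‖x‖ ∂ν) := by
    intro u
    have e : g u - ∫ x, g x ∂ν = ∫ x, (g u - g x) ∂ν := by
      rw [integral_sub (integrable_const _) (hgi ν)]; simp
    have e2 : p + q * (‖u‖ + ∫ x, ‖x‖ ∂ν) = ∫ x, (p + q * (‖u‖ + ‖x‖)) ∂ν := by
      have i : Integrable (fun x => ‖u‖ + ‖x‖) ν := (integrable_const _).add hν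
      rw [integral_add (integrable_const _) (i.const_mul q), integral_const_mul, integral_add (integrable_const _) hν]; simp
    rw [e, e2]
    exact abs_integral_le_integral_abs.trans (integral_mono ((integrable_const _).sub (hgi ν)).abs
      ((integrable_const _).add (((integrable_const _).add hν).const_mul q)) fun x => hosc u x)
  have e : ∫ x, g x ∂μ - ∫ x, g x ∂ν = ∫ u, (g u - ∫ x, g x ∂ν) ∂μ := by
    rw [integral_sub (hgi μ) (integrable_const _)]; simp
  have e2 : p + q * (∫ x, ‖x‖ ∂μ + ∫ x, ‖x‖ ∂ν) = ∫ u, (p + q * (‖u‖ + ∫ x, ‖x‖ ∂ν)) ∂μ := by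
    have i : Integrable (fun u => ‖u‖ + ∫ x, ‖x‖ ∂ν) μ := hμ.add (integrable_const _)
    rw [integral_add (integrable_const _) (i.const_mul q), integral_const_mul, integral_add hμ (integrable_const _)]; simp
  rw [e, e2]
  exact abs_integral_le_integral_abs.trans (integral_mono ((hgi μ).sub (integrable_const _)).abs
    ((integrable_const _).add ((hμ.add (integrable_const _)).const_mul q)) h1)

variable {E : Type*} [NormedAddCommGroup E] [InnerProductSpace ℝ E] [FiniteDimensional ℝ E]
  [MeasurableSpace E] [BorelSpace E]

/-- The Markov operator of the unadjusted Langevin step. -/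
def stepOp (δ : ℝ) (b : E → E) (f : E → ℝ) (x : E) : ℝ :=
  ∫ z, f (x + δ • b x + √(2 * δ) • z) ∂stdGaussian E

lemma measurable_stepOp {δ : ℝ} {b : E → E} (hb : Measurable b) {f : E → ℝ} (hf : Measurable f) :
    Measurable (stepOp δ b f) := by
  have : Measurable (fun p : E × E => f (p.1 + δ • b p.1 + √(2 * δ) • p.2)) :=
    hf.comp (by fun_prop)
  exact this.stronglyMeasurable.integral_prod_right.measurable

lemma abs_stepOp_le {δ : ℝ} {b : E → E} {f : E → ℝ} {M : ℝ} (hM : ∀ x, |f x| ≤ M) (x : E) :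
    |stepOp δ b f x| ≤ M := by
  have := norm_integral_le_of_norm_le_const (μ := stdGaussian E)
    (f := fun z => f (x + δ • b x + √(2 * δ) • z)) (Filter.Eventually.of_forall fun z => hM _)
  rwa [probReal_univ, mul_one] at this

/-- Invariance of `π`, tested on bounded measurable functions. -/
def IsInvariantMeasure (δ : ℝ) (b : E → E) (π : Measure E) : Prop :=
  ∀ f : E → ℝ, Measurable f → (∃ M : ℝ, ∀ x, |f x| ≤ M) → ∫ x, stepOp δ b f x ∂π = ∫ x, f x ∂π

/-- The partial sums `∑_{i < n} Rⁱ f`. -/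
def potentialSum (δ : ℝ) (b : E → E) (f : E → ℝ) : ℕ → E → ℝ
  | 0 => 0
  | n + 1 => fun x => f x + stepOp δ b (potentialSum δ b f n) x

lemma measurable_potentialSum {δ : ℝ} {b : E → E} (hb : Measurable b) {f : E → ℝ}
    (hf : Measurable f) : ∀ n, Measurable (potentialSum δ b f n)
  | 0 => measurable_const
  | n + 1 => hf.add (measurable_stepOp hb (measurable_potentialSum hb hf n))

lemma abs_potentialSum_le {δ : ℝ} {b : E → E} {f : E → ℝ} (hf : ∀ x, |f x| ≤ 1) :
    ∀ (n : ℕ) (x : E), |potentialSum δ b f n x| ≤ n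
  | 0, x => by simp [potentialSum]
  | n + 1, x => by
    refine (abs_add_le _ _).trans ?_
    push_cast
    linarith [hf x, abs_stepOp_le (δ := δ) (b := b) (abs_potentialSum_le (δ := δ) (b := b) hf n) x]

lemma abs_potentialSum_sub_le {δ : ℝ} {b : E → E} (hb : Measurable b) {Φ : ℝ → ℝ}
    (hΦ0 : ∀ t, 0 ≤ t → 0 ≤ Φ t)
    (hcontr : ∀ g : E → ℝ, Measurable g → (∃ M : ℝ, ∀ x, |g x| ≤ M) →
      (∀ u v, u ≠ v → |g u - g v| ≤ Φ ‖u - v‖) →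
      ∀ u v, u ≠ v → |stepOp δ b g u - stepOp δ b g v| ≤ Φ ‖u - v‖ - 2)
    {f : E → ℝ} (hf : Measurable f) (hf1 : ∀ x, |f x| ≤ 1) :
    ∀ (n : ℕ) (u v : E), u ≠ v →
      |potentialSum δ b f n u - potentialSum δ b f n v| ≤ Φ ‖u - v‖
  | 0, u, v, _ => by simpa [potentialSum] using hΦ0 _ (norm_nonneg _)
  | n + 1, u, v, huv => by
    have h := hcontr _ (measurable_potentialSum hb hf n) ⟨n, abs_potentialSum_le hf1 n⟩
      (abs_potentialSum_sub_le hb hΦ0 hcontr hf hf1 n) u v huv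
    have h1 := abs_le.1 (hf1 u)
    have h2 := abs_le.1 (hf1 v)
    have h3 := abs_le.1 h
    simp only [potentialSum]
    rw [abs_le]
    constructor <;> linarith [h1.1, h1.2, h2.1, h2.2, h3.1, h3.2]

lemma le_of_forall_nat_mul_le {a c x : ℝ} (h : ∀ n : ℕ, n * a ≤ c + n * x) : a ≤ x := by
  by_contra! hax
  obtain ⟨n, hn⟩ := exists_nat_gt (c / (a - x))
  rw [div_lt_iff₀ (by linarith)] at hn
  linarith [h n]

/-- Perturbation bound for invariant measures by the Poisson equation method. -/
lemma abs_integral_sub_le_of_invariant {δ : ℝ} {b₁ b₂ : E → E} (hb₁ : Measurable b₁)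
    (hb₂ : Measurable b₂) {Φ : ℝ → ℝ} (hΦ0 : ∀ t, 0 ≤ t → 0 ≤ Φ t) {p q : ℝ} (hq : 0 ≤ q)
    (hΦ1 : ∀ t, 0 ≤ t → Φ t ≤ p + q * t)
    (hcontr : ∀ g : E → ℝ, Measurable g → (∃ M : ℝ, ∀ x, |g x| ≤ M) →
      (∀ u v, u ≠ v → |g u - g v| ≤ Φ ‖u - v‖) →
      ∀ u v, u ≠ v → |stepOp δ b₂ g u - stepOp δ b₂ g v| ≤ Φ ‖u - v‖ - 2)
    {Q : ℝ} (hpert : ∀ g : E → ℝ, Measurable g → (∃ M : ℝ, ∀ x, |g x| ≤ M) →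
      (∀ u v, u ≠ v → |g u - g v| ≤ Φ ‖u - v‖) →
      ∀ x, |stepOp δ b₁ g x - stepOp δ b₂ g x| ≤ Q * ‖b₁ x - b₂ x‖)
    {π₁ π₂ : Measure E} [IsProbabilityMeasure π₁] [IsProbabilityMeasure π₂]
    (hπ₁ : IsInvariantMeasure δ b₁ π₁) (hπ₂ : IsInvariantMeasure δ b₂ π₂)
    (hμ : Integrable (fun x => ‖x‖) π₁) (hν : Integrable (fun x => ‖x‖) π₂)
    (hbi : Integrable (fun x => ‖b₁ x - b₂ x‖) π₁)
    {f : E → ℝ} (hf : Measurable f) (hf1 : ∀ x, |f x| ≤ 1) :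
    |∫ x, f x ∂π₁ - ∫ x, f x ∂π₂| ≤ Q * ∫ x, ‖b₁ x - b₂ x‖ ∂π₁ := by
  have hint : ∀ (ρ : Measure E) [IsProbabilityMeasure ρ] {g : E → ℝ} {M : ℝ}, Measurable g →
      (∀ x, |g x| ≤ M) → Integrable g ρ := fun ρ _ g M hg hM =>
    Integrable.of_bound hg.aestronglyMeasurable M (Filter.Eventually.of_forall hM)
  set F := potentialSum δ b₂ f with hF
  have hFm : ∀ n, Measurable (F n) := measurable_potentialSum hb₂ hf
  have hFb : ∀ n x, |F n x| ≤ n := abs_potentialSum_le hf1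
  have hFosc : ∀ n u v, u ≠ v → |F n u - F n v| ≤ Φ ‖u - v‖ :=
    abs_potentialSum_sub_le hb₂ hΦ0 hcontr hf hf1
  have hbdd : ∀ n, |∫ x, F n x ∂π₁ - ∫ x, F n x ∂π₂| ≤ p + q * (∫ x, ‖x‖ ∂π₁ + ∫ x, ‖x‖ ∂π₂) := by
    refine fun n => abs_integral_sub_le_of_osc hμ hν (hFm n) (hFb n) fun u v => ?_
    have h1 := hΦ1 ‖u - v‖ (norm_nonneg _)
    have h2 := mul_le_mul_of_nonneg_left (norm_sub_le u v) hq
    rcases eq_or_ne u v with rfl | huv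
    · have h3 := hΦ0 ‖u - u‖ (norm_nonneg _)
      rw [sub_self, abs_zero]; linarith
    · linarith [hFosc n u v huv]
  set X := Q * ∫ x, ‖b₁ x - b₂ x‖ ∂π₁ with hX
  -- Invariance of `π₁` turns the second integral into that of `stepOp δ b₁ (F n)`, so the
  -- perturbation bound applies.
  have herr : ∀ n, |∫ x, stepOp δ b₂ (F n) x ∂π₁ - ∫ x, F n x ∂π₁| ≤ X := by
    intro n
    rw [← hπ₁ (F n) (hFm n) ⟨n, hFb n⟩, hX, ← integral_const_mul, abs_sub_comm, ← integral_sub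
      (hint π₁ (measurable_stepOp hb₁ (hFm n)) (abs_stepOp_le (hFb n)))
      (hint π₁ (measurable_stepOp hb₂ (hFm n)) (abs_stepOp_le (hFb n)))]
    refine abs_integral_le_integral_abs.trans (integral_mono ?_ (hbi.const_mul Q) fun x =>
      hpert _ (hFm n) ⟨n, hFb n⟩ (hFosc n) x)
    exact ((hint π₁ (measurable_stepOp hb₁ (hFm n)) (abs_stepOp_le (hFb n))).sub
      (hint π₁ (measurable_stepOp hb₂ (hFm n)) (abs_stepOp_le (hFb n)))).abs
  have hrec : ∀ n (ρ : Measure E) [IsProbabilityMeasure ρ],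
      ∫ x, F (n + 1) x ∂ρ = ∫ x, f x ∂ρ + ∫ x, stepOp δ b₂ (F n) x ∂ρ := fun n ρ _ =>
    integral_add (hint ρ hf hf1) (hint ρ (measurable_stepOp hb₂ (hFm n)) (abs_stepOp_le (hFb n)))
  set e := ∫ x, f x ∂π₁ - ∫ x, f x ∂π₂ with he
  have hsum : ∀ n : ℕ, |(∫ x, F n x ∂π₁ - ∫ x, F n x ∂π₂) - n * e| ≤ n * X := by
    intro n
    induction n with
    | zero => simp [hF, potentialSum]
    | succ n ih =>
      have h1 := hrec n π₁
      have h2 := hrec n π₂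
      rw [hπ₂ (F n) (hFm n) ⟨n, hFb n⟩] at h2
      have h3 := abs_le.1 (herr n)
      have h4 := abs_le.1 ih
      push_cast
      rw [abs_le]
      constructor <;> linarith [h3.1, h3.2, h4.1, h4.2]
  refine le_of_forall_nat_mul_le (c := p + q * (∫ x, ‖x‖ ∂π₁ + ∫ x, ‖x‖ ∂π₂)) fun n => ?_
  have h1 := abs_le.1 (hsum n)
  have h2 := abs_le.1 (hbdd n)
  rw [← abs_of_nonneg (Nat.cast_nonneg' (α := ℝ) n), ← abs_mul]
  rw [abs_of_nonneg (Nat.cast_nonneg' (α := ℝ) n), abs_le]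
  constructor <;> linarith [h1.1, h1.2, h2.1, h2.2]

end PnPULA

/-! ### Contraction of the mean step and moments of invariant laws. -/

namespace PnPULA
open MeasureTheory ProbabilityTheory Filter

/-- On squaring, the condition `δ * l ≤ 1 / 3` makes the term in `δ ^ 2` eat at most half of the
contraction, so the rate drops from `1 / (2 * lam)` to `1 / (4 * lam)`. What is left is the square
of the right side without its `δ ^ 2` part. -/
lemma norm_add_smul_sub_le {E : Type*} [NormedAddCommGroup E] [InnerProductSpace ℝ E]
    {lam β l δ : ℝ} (hlam : 0 < lam) (hβ : 0 ≤ β) (hδ : 0 < δ)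
    (hl1 : 1 / lam ≤ l) (hl2 : l ≤ 3 / (2 * lam)) (hδl : δ * l ≤ 1 / 3) {b : E → E} {u v : E}
    (hinner : inner ℝ (b u - b v) (u - v) ≤ -(1 / (2 * lam)) * ‖u - v‖ ^ 2 + β * ‖u - v‖)
    (hlip : ‖b u - b v‖ ≤ l * ‖u - v‖) :
    ‖(u + δ • b u) - (v + δ • b v)‖ ≤ ‖u - v‖ + δ * (β - 1 / (4 * lam) * ‖u - v‖) := by
  set r := ‖u - v‖ with hr
  have hr0 : 0 ≤ r := norm_nonneg _
  obtain ⟨i, hi⟩ : ∃ i, i = 1 / (4 * lam) := ⟨_, rfl⟩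
  have hi0 : 0 < i := by rw [hi]; positivity
  have e1 : 1 / lam = 4 * i := by rw [hi]; field_simp
  have e2 : 1 / (2 * lam) = 2 * i := by rw [hi]; field_simp; norm_num
  have e3 : 3 / (2 * lam) = 6 * i := by rw [hi]; field_simp; norm_num
  rw [e1] at hl1
  rw [e2] at hinner
  rw [e3] at hl2
  rw [← hi]
  have hδi : δ * i ≤ 1 := by nlinarith
  have hsq : ‖(u + δ • b u) - (v + δ • b v)‖ ^ 2
      = r ^ 2 + 2 * (δ * inner ℝ (b u - b v) (u - v)) + δ ^ 2 * ‖b u - b v‖ ^ 2 := by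
    have : (u + δ • b u) - (v + δ • b v) = (u - v) + δ • (b u - b v) := by module
    rw [this, norm_add_sq_real, real_inner_smul_right, real_inner_comm, norm_smul, mul_pow,
      Real.norm_eq_abs, sq_abs]
  have h1 : δ ^ 2 * ‖b u - b v‖ ^ 2 ≤ 2 * δ * i * r ^ 2 := by
    have h2 : ‖b u - b v‖ ^ 2 ≤ (l * r) ^ 2 := pow_le_pow_left₀ (norm_nonneg _) hlip 2
    have h3 : δ * l * (δ * l) ≤ 1 / 3 * (δ * (6 * i)) := by
      refine mul_le_mul hδl (by gcongr) ?_ (by norm_num)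
      exact mul_nonneg hδ.le (by linarith)
    calc δ ^ 2 * ‖b u - b v‖ ^ 2 ≤ δ ^ 2 * (l * r) ^ 2 := by gcongr
      _ = δ * l * (δ * l) * r ^ 2 := by ring
      _ ≤ 1 / 3 * (δ * (6 * i)) * r ^ 2 := by gcongr
      _ = _ := by ring
  have h2 := mul_le_mul_of_nonneg_left hinner hδ.le
  have hx : 0 ≤ r + δ * (β - i * r) := by
    have := mul_nonneg hδ.le hβ
    nlinarith [mul_nonneg hr0 (sub_nonneg.2 hδi)]
  refine le_of_sq_le_sq ?_ hx
  rw [hsq]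
  nlinarith [sq_nonneg (δ * (β - i * r))]

section
variable {E : Type*} [NormedAddCommGroup E] [InnerProductSpace ℝ E] [FiniteDimensional ℝ E]
  [MeasurableSpace E] [BorelSpace E]

lemma integrable_norm_sq_stdGaussian :
    Integrable (fun z : E => ‖z‖ ^ 2) (stdGaussian E) :=
  (IsGaussian.memLp_two_id (μ := stdGaussian E)).norm.integrable_sq

lemma integrable_norm_add_smul_sq_stdGaussian (a : E) (s : ℝ) :
    Integrable (fun z : E => ‖a + s • z‖ ^ 2) (stdGaussian E) :=
  (((memLp_const a).add ((IsGaussian.memLp_two_id (μ := stdGaussian E)).const_smul s))).norm.integrable_sq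

lemma integral_norm_add_smul_sq_stdGaussian (a : E) (s : ℝ) :
    ∫ z, ‖a + s • z‖ ^ 2 ∂stdGaussian E = ‖a‖ ^ 2 + s ^ 2 * ∫ z, ‖z‖ ^ 2 ∂stdGaussian E := by
  have h0 : ∫ z, inner ℝ a z ∂stdGaussian E = 0 := by
    have := integral_strongDual_stdGaussian (innerSL ℝ a)
    simpa using this
  have hi : Integrable (fun z => inner ℝ a z) (stdGaussian E) :=
    (innerSL ℝ a).integrable_comp IsGaussian.integrable_id
  have e : ∀ z : E, ‖a + s • z‖ ^ 2 = ‖a‖ ^ 2 + 2 * s * inner ℝ a z + s ^ 2 * ‖z‖ ^ 2 := by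
    intro z
    rw [norm_add_sq_real, real_inner_smul_right, norm_smul, mul_pow, Real.norm_eq_abs, sq_abs]
    ring
  simp_rw [e]
  have i1 : Integrable (fun z => ‖a‖ ^ 2 + 2 * s * inner ℝ a z) (stdGaussian E) :=
    (integrable_const _).add (hi.const_mul _)
  rw [integral_add i1 (integrable_norm_sq_stdGaussian.const_mul _),
    integral_add (integrable_const _) (hi.const_mul _), integral_const_mul, integral_const_mul, h0]
  simp

/-- Second moment bound for invariant measures. -/
lemma integral_norm_sq_le_of_invariant {δ θ q : ℝ} {b : E → E} (hb : Measurable b) (hδ : 0 < δ)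
    (hθ : 0 < θ) (hθ1 : θ ≤ 1)
    (hdrift : ∀ x, ‖x + δ • b x‖ ≤ (1 - θ) * ‖x‖ + θ * q) {π : Measure E} [IsProbabilityMeasure π]
    (hπ : IsInvariantMeasure δ b π) :
    Integrable (fun x => ‖x‖ ^ 2) π ∧
      ∫ x, ‖x‖ ^ 2 ∂π ≤ q ^ 2 + 2 * δ / θ * ∫ z, ‖z‖ ^ 2 ∂stdGaussian E := by
  set m := ∫ z, ‖z‖ ^ 2 ∂stdGaussian E with hm
  have hm0 : 0 ≤ m := integral_nonneg fun z => by positivity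
  set Q := q ^ 2 + 2 * δ / θ * m with hQ
  have hQ0 : 0 ≤ Q := by positivity
  have hθQ : θ * Q = θ * q ^ 2 + 2 * δ * m := by rw [hQ]; field_simp
  have hstep : ∀ x, ‖x + δ • b x‖ ^ 2 + 2 * δ * m ≤ (1 - θ) * ‖x‖ ^ 2 + θ * Q := by
    intro x
    have h1 : ‖x + δ • b x‖ ^ 2 ≤ ((1 - θ) * ‖x‖ + θ * q) ^ 2 :=
      pow_le_pow_left₀ (norm_nonneg _) (hdrift x) 2
    have h2 : (1 - θ) * ‖x‖ ^ 2 + θ * q ^ 2 - ((1 - θ) * ‖x‖ + θ * q) ^ 2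
        = θ * (1 - θ) * (‖x‖ - q) ^ 2 := by ring
    have h3 : 0 ≤ θ * (1 - θ) * (‖x‖ - q) ^ 2 :=
      mul_nonneg (mul_nonneg hθ.le (by linarith)) (sq_nonneg _)
    linarith
  set φ : ℕ → Set E := fun n => {x | ‖x‖ ^ 2 ≤ n} with hφ
  have hφm : ∀ n, MeasurableSet (φ n) := fun n =>
    measurableSet_le (by fun_prop) measurable_const
  have hcover : AECover π atTop φ := by
    refine ⟨Eventually.of_forall fun x => ?_, hφm⟩
    obtain ⟨N, hN⟩ := exists_nat_ge (‖x‖ ^ 2)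
    filter_upwards [eventually_ge_atTop N] with n hn
    exact hN.trans (by exact_mod_cast hn)
  have hbound : ∀ n : ℕ, Integrable ((φ n).indicator fun x => ‖x‖ ^ 2) π ∧
      ∫ x in φ n, ‖x‖ ^ 2 ∂π ≤ Q := by
    intro n
    -- No moment of `π` is known yet and invariance is tested on bounded functions only, hence the
    -- truncation.
    set f : E → ℝ := fun x => min (‖x‖ ^ 2) n with hf
    have hfm : Measurable f := by fun_prop
    have hfb : ∀ x, |f x| ≤ n := fun x => by
      rw [abs_of_nonneg (le_min (by positivity) (Nat.cast_nonneg _))]; exact min_le_right _ _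
    have hfi : Integrable f π := Integrable.of_bound hfm.aestronglyMeasurable n
      (Eventually.of_forall hfb)
    have hsi : Integrable (stepOp δ b f) π :=
      Integrable.of_bound (measurable_stepOp hb hfm).aestronglyMeasurable n
        (Eventually.of_forall (abs_stepOp_le hfb))
    have hgi : Integrable ((φ n).indicator fun x => ‖x‖ ^ 2) π := by
      refine Integrable.of_bound (C := n) (Measurable.aestronglyMeasurable
        (Measurable.indicator (by fun_prop) (hφm n))) (Eventually.of_forall fun x => ?_)
      by_cases hx : x ∈ φ n
      · rw [Set.indicator_of_mem hx, Real.norm_of_nonneg (by positivity)]; exact hx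
      · rw [Set.indicator_of_notMem hx]; simp
    refine ⟨hgi, ?_⟩
    have hPf : ∀ x, stepOp δ b f x ≤ min ((1 - θ) * ‖x‖ ^ 2 + θ * Q) (n : ℝ) := by
      intro x
      refine le_min ?_ ((le_abs_self _).trans (abs_stepOp_le hfb x))
      refine le_trans ?_ (hstep x)
      have e := integral_norm_add_smul_sq_stdGaussian (x + δ • b x) √(2 * δ)
      rw [Real.sq_sqrt (by positivity)] at e
      rw [← e]
      refine integral_mono_of_nonneg (Eventually.of_forall fun z => ?_)
        (integrable_norm_add_smul_sq_stdGaussian _ _) (Eventually.of_forall fun z => ?_)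
      · exact le_min (by positivity) (Nat.cast_nonneg _)
      · exact min_le_left _ _
    -- Outside `φ n` the truncation is at its maximum, so the right side is nonnegative. Integrated
    -- against `π`, the right side vanishes.
    have hpt : ∀ x, θ * (φ n).indicator (fun x => ‖x‖ ^ 2) x - θ * Q ≤ f x - stepOp δ b f x := by
      intro x
      have h := hPf x
      by_cases hx : x ∈ φ n
      · rw [Set.indicator_of_mem hx]
        have h1 : f x = ‖x‖ ^ 2 := min_eq_left hx
        linarith [min_le_left ((1 - θ) * ‖x‖ ^ 2 + θ * Q) (n : ℝ)]
      · rw [Set.indicator_of_notMem hx]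
        have h1 : f x = n := min_eq_right (not_le.1 hx).le
        have := mul_nonneg hθ.le hQ0
        linarith [min_le_right ((1 - θ) * ‖x‖ ^ 2 + θ * Q) (n : ℝ)]
    have := integral_mono ((hgi.const_mul θ).sub (integrable_const _)) (hfi.sub hsi) hpt
    simp only [Pi.sub_apply] at this
    rw [integral_sub hfi hsi, hπ f hfm ⟨n, hfb⟩, sub_self,
      integral_sub (hgi.const_mul θ) (integrable_const _), integral_const_mul,
      integral_indicator (hφm n)] at this
    simp only [integral_const, probReal_univ, one_smul, sub_nonpos] at this
    exact le_of_mul_le_mul_left this hθ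
  have hint : Integrable (fun x => ‖x‖ ^ 2) π := by
    refine hcover.integrable_of_integral_bounded_of_nonneg_ae Q
      (fun n => (integrable_indicator_iff (hφm n)).1 (hbound n).1)
      (Eventually.of_forall fun x => by positivity) (Eventually.of_forall fun n => (hbound n).2)
  exact ⟨hint, le_of_tendsto (hcover.integral_tendsto_of_countably_generated hint)
    (Eventually.of_forall fun n => (hbound n).2)⟩

end

lemma isInvariantMeasure_of_isInvariantLaw {d : ℕ} {δ : ℝ} {b : Euc d → Euc d} (hb : Measurable b)
    {π : Measure (Euc d)} (hπ : IsInvariantLaw δ b π) : IsInvariantMeasure δ b π := by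
  obtain ⟨hp, hinv⟩ := hπ
  intro f hf ⟨M, hM⟩
  have hT : Measurable (fun p : Euc d × Euc d => p.1 + δ • b p.1 + √(2 * δ) • p.2) := by fun_prop
  have hmap : (π.prod (stdGaussian (Euc d))).map
      (fun p : Euc d × Euc d => p.1 + δ • b p.1 + √(2 * δ) • p.2) = π := by
    ext B hB
    rw [Measure.map_apply hT hB, Measure.prod_apply (hT hB), ← hinv B hB]
    refine lintegral_congr fun x => ?_
    rw [ulaStep, Measure.map_apply (by fun_prop) hB]
    rfl
  conv_rhs => rw [← hmap]
  rw [integral_map hT.aemeasurable hf.aestronglyMeasurable, integral_prod]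
  · rfl
  · exact Integrable.of_bound (hf.comp hT).aestronglyMeasurable M (Eventually.of_forall fun _ => hM _)

end PnPULA

/-! ### Projection, likelihood score and the estimates on the drift. -/

namespace PnPULA
open MeasureTheory ProbabilityTheory Filter

lemma inner_sub_projOnto_le_zero {d : ℕ} {S : Set (Euc d)} (hne : S.Nonempty) (hconv : Convex ℝ S)
    (hS : IsCompact S) (x : Euc d) {w : Euc d} (hw : w ∈ S) :
    inner ℝ (x - projOnto S x) (w - projOnto S x) ≤ 0 := by
  obtain ⟨hmem, hmin⟩ := projOnto_spec hne hS x
  refine (norm_eq_iInf_iff_real_inner_le_zero hconv hmem).1 ?_ w hw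
  have : Nonempty S := hne.to_subtype
  refine le_antisymm (le_ciInf fun z => hmin z z.2) ?_
  exact ciInf_le (f := fun z : S => ‖x - z‖)
    ⟨0, by rintro _ ⟨z, rfl⟩; exact norm_nonneg _⟩ ⟨_, hmem⟩

/-- Firm nonexpansiveness: add the variational inequalities at `u` and `v`. It makes the residual
`projOnto S u - u` 1-Lipschitz, so `1 / lam` and not `2 / lam` enters the Lipschitz constant of the
drift. -/
lemma norm_sq_projOnto_sub_le {d : ℕ} {S : Set (Euc d)} (hne : S.Nonempty) (hconv : Convex ℝ S)
    (hS : IsCompact S) (u v : Euc d) :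
    ‖projOnto S u - projOnto S v‖ ^ 2 ≤ inner ℝ (projOnto S u - projOnto S v) (u - v) := by
  have h1 := inner_sub_projOnto_le_zero hne hconv hS u (projOnto_spec hne hS v).1
  have h2 := inner_sub_projOnto_le_zero hne hconv hS v (projOnto_spec hne hS u).1
  have h3 : inner ℝ (projOnto S u - projOnto S v) (u - v) - ‖projOnto S u - projOnto S v‖ ^ 2 =
      -(inner ℝ (u - projOnto S u) (projOnto S v - projOnto S u)
        + inner ℝ (v - projOnto S v) (projOnto S u - projOnto S v)) := by
    rw [← real_inner_self_eq_norm_sq]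
    simp only [inner_sub_left, inner_sub_right, real_inner_comm]
    ring
  linarith

lemma norm_projOnto_sub_self_sub_le {d : ℕ} {S : Set (Euc d)} (hne : S.Nonempty)
    (hconv : Convex ℝ S) (hS : IsCompact S) (u v : Euc d) :
    ‖(projOnto S u - u) - (projOnto S v - v)‖ ≤ ‖u - v‖ := by
  have h := norm_sq_projOnto_sub_le hne hconv hS u v
  have e : (projOnto S u - u) - (projOnto S v - v) = (projOnto S u - projOnto S v) - (u - v) := by
    abel
  refine le_of_sq_le_sq ?_ (norm_nonneg _)
  rw [e, norm_sub_sq_real]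
  nlinarith [sq_nonneg ‖projOnto S u - projOnto S v‖]

/-- The observation matrix as a continuous linear map between Euclidean spaces. -/
def obsMap {d k : ℕ} (A : Matrix (Fin k) (Fin d) ℝ) : Euc d →L[ℝ] Euc k :=
  LinearMap.toContinuousLinearMap (Matrix.toEuclideanLin A)

lemma norm_obsMap {d k : ℕ} (A : Matrix (Fin k) (Fin d) ℝ) : ‖obsMap A‖ = ‖A‖ := by
  rw [Matrix.l2_opNorm_def]; rfl

lemma obsMap_sub {d k : ℕ} (A₁ A₂ : Matrix (Fin k) (Fin d) ℝ) :
    obsMap (A₁ - A₂) = obsMap A₁ - obsMap A₂ := by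
  simp [obsMap]

lemma likelihoodScore_eq {d k : ℕ} {σ : ℝ} (hσ : 0 < σ) (A : Matrix (Fin k) (Fin d) ℝ) (y : Euc k)
    (x : Euc d) :
    likelihoodScore σ A y x = (σ ^ 2)⁻¹ • (obsMap A).adjoint (y - obsMap A x) := by
  have hlog : (fun x' => Real.log (likelihood σ A y x')) = fun x' =>
      Real.log ((2 * Real.pi * σ ^ 2) ^ (-(k : ℝ) / 2)) +
        -(2 * σ ^ 2)⁻¹ * ‖y - obsMap A x'‖ ^ 2 := by
    funext x'
    rw [likelihood, Real.log_mul (by positivity) (Real.exp_pos _).ne', Real.log_exp]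
    simp only [obsMap, LinearMap.coe_toContinuousLinearMap']
    ring
  rw [likelihoodScore, hlog]
  refine HasGradientAt.gradient ?_
  rw [hasGradientAt_iff_hasFDerivAt]
  have h1 : HasFDerivAt (fun x' => y - obsMap A x') (-(obsMap A)) x :=
    (obsMap A).hasFDerivAt.const_sub y
  have h2 := (h1.norm_sq.const_mul (-(2 * σ ^ 2)⁻¹)).const_add
    (Real.log ((2 * Real.pi * σ ^ 2) ^ (-(k : ℝ) / 2)))
  refine h2.congr_fderiv ?_
  ext w
  simp [ContinuousLinearMap.adjoint_inner_left]
  ring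

lemma norm_likelihoodScore_sub_le {d k : ℕ} {σ K : ℝ} (hσ : 0 < σ)
    {A₁ A₂ : Matrix (Fin k) (Fin d) ℝ} (h₁ : ‖A₁‖ ≤ K) (h₂ : ‖A₂‖ ≤ K) (y : Euc k) (x : Euc d) :
    ‖likelihoodScore σ A₁ y x - likelihoodScore σ A₂ y x‖ ≤
      (σ ^ 2)⁻¹ * (‖A₁ - A₂‖ * (‖y‖ + 2 * K * ‖x‖)) := by
  rw [likelihoodScore_eq hσ, likelihoodScore_eq hσ, ← smul_sub, norm_smul,
    Real.norm_of_nonneg (by positivity)]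
  gcongr
  have hK : 0 ≤ K := (norm_nonneg _).trans h₁
  have e : (obsMap A₁).adjoint (y - obsMap A₁ x) - (obsMap A₂).adjoint (y - obsMap A₂ x) =
      (obsMap (A₁ - A₂)).adjoint (y - obsMap A₁ x)
        - (obsMap A₂).adjoint (obsMap (A₁ - A₂) x) := by
    rw [obsMap_sub]; simp only [map_sub, sub_apply]; abel
  have n1 : ‖obsMap A₁ x‖ ≤ K * ‖x‖ :=
    ((obsMap A₁).le_opNorm x).trans (by rw [norm_obsMap]; gcongr)
  have n2 : ‖(obsMap (A₁ - A₂)).adjoint (y - obsMap A₁ x)‖ ≤ ‖A₁ - A₂‖ * (‖y‖ + K * ‖x‖) := by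
    refine (ContinuousLinearMap.le_opNorm _ _).trans ?_
    rw [LinearIsometryEquiv.norm_map, norm_obsMap]
    gcongr
    exact (norm_sub_le _ _).trans (by gcongr)
  have n3 : ‖(obsMap A₂).adjoint (obsMap (A₁ - A₂) x)‖ ≤ K * (‖A₁ - A₂‖ * ‖x‖) := by
    refine (ContinuousLinearMap.le_opNorm _ _).trans ?_
    rw [LinearIsometryEquiv.norm_map, norm_obsMap]
    gcongr
    exact (ContinuousLinearMap.le_opNorm _ _).trans (by rw [norm_obsMap])
  rw [e]
  refine (norm_sub_le _ _).trans ((add_le_add n2 n3).trans (le_of_eq ?_))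
  ring

section drift

variable {d k : ℕ} {y : Euc k} {σ ε lam L M m K R : ℝ} {D : Euc d → Euc d} {S : Set (Euc d)}
  {A : Matrix (Fin k) (Fin d) ℝ}

lemma drift_sub_drift (u v : Euc d) :
    drift σ ε lam D S y A u - drift σ ε lam D S y A v =
      (likelihoodScore σ A y u - likelihoodScore σ A y v)
        + (1 / ε) • ((D u - D v) - (u - v))
        + (1 / lam) • ((projOnto S u - u) - (projOnto S v - v)) := by
  simp only [drift]; module

lemma norm_drift_sub_le (hε : 0 < ε) (hlam : 0 < lam)
    (hD : ∀ x₁ x₂ : Euc d, ‖D x₁ - D x₂‖ ≤ M * ‖x₁ - x₂‖) (hne : S.Nonempty) (hconv : Convex ℝ S)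
    (hS : IsCompact S) (hA : ScoreLipschitz σ y L A) (u v : Euc d) :
    ‖drift σ ε lam D S y A u - drift σ ε lam D S y A v‖ ≤
      (L + (M + 1) / ε + 1 / lam) * ‖u - v‖ := by
  rw [drift_sub_drift]
  have h1 := hA u v
  have h2 : ‖(1 / ε) • ((D u - D v) - (u - v))‖ ≤ (M + 1) / ε * ‖u - v‖ := by
    rw [norm_smul, Real.norm_of_nonneg (by positivity)]
    calc 1 / ε * ‖(D u - D v) - (u - v)‖ ≤ 1 / ε * (M * ‖u - v‖ + ‖u - v‖) := by
          gcongr; exact (norm_sub_le _ _).trans (by gcongr; exact hD u v)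
      _ = _ := by ring
  have h3 : ‖(1 / lam) • ((projOnto S u - u) - (projOnto S v - v))‖ ≤ 1 / lam * ‖u - v‖ := by
    rw [norm_smul, Real.norm_of_nonneg (by positivity)]
    gcongr
    exact norm_projOnto_sub_self_sub_le hne hconv hS u v
  refine (norm_add₃_le).trans ?_
  linarith

/-- The projections of two points differ by at most the diameter bound `R`, so the last term of the
drift contracts at rate `1 / lam` up to a linear error. By `hparam`, score and denoiser use up at
most half of that rate. -/
lemma inner_drift_sub_le (hε : 0 < ε) (hlam : 0 < lam) (hL : 0 < L)
    (hparam : 2 * lam * (L + (M + 1) / ε - min m 0) ≤ 1)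
    (hD : ∀ x₁ x₂ : Euc d, ‖D x₁ - D x₂‖ ≤ M * ‖x₁ - x₂‖) (hne : S.Nonempty)
    (hS : IsCompact S) (hR : ∀ p ∈ S, ∀ q ∈ S, ‖p - q‖ ≤ R) (hA : ScoreMonotone σ y m A)
    (u v : Euc d) :
    inner ℝ (drift σ ε lam D S y A u - drift σ ε lam D S y A v) (u - v) ≤
      -(1 / (2 * lam)) * ‖u - v‖ ^ 2 + R / lam * ‖u - v‖ := by
  rw [drift_sub_drift]
  simp only [inner_add_left, real_inner_smul_left]
  set r := ‖u - v‖ with hr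
  have hr0 : 0 ≤ r := norm_nonneg _
  have h1 := hA v u
  have h2 : inner ℝ ((D u - D v) - (u - v)) (u - v) ≤ (M + 1) * r ^ 2 := by
    have h3 := real_inner_le_norm (D u - D v) (u - v)
    have h4 := mul_le_mul_of_nonneg_right (hD u v) hr0
    rw [inner_sub_left, real_inner_self_eq_norm_sq]
    nlinarith [sq_nonneg r]
  have h3 : inner ℝ ((projOnto S u - u) - (projOnto S v - v)) (u - v) ≤ R * r - r ^ 2 := by
    have e : (projOnto S u - u) - (projOnto S v - v) = (projOnto S u - projOnto S v) - (u - v) := by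
      abel
    have h4 := real_inner_le_norm (projOnto S u - projOnto S v) (u - v)
    have h5 := mul_le_mul_of_nonneg_right
      (hR _ (projOnto_spec hne hS u).1 _ (projOnto_spec hne hS v).1) hr0
    rw [e, inner_sub_left, real_inner_self_eq_norm_sq]
    linarith
  have h4 : 1 / ε * inner ℝ ((D u - D v) - (u - v)) (u - v) ≤ (M + 1) / ε * r ^ 2 := by
    calc _ ≤ 1 / ε * ((M + 1) * r ^ 2) := by gcongr
      _ = _ := by ring
  have h5 : 1 / lam * inner ℝ ((projOnto S u - u) - (projOnto S v - v)) (u - v) ≤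
      R / lam * r - 1 / lam * r ^ 2 := by
    calc _ ≤ 1 / lam * (R * r - r ^ 2) := by gcongr
      _ = _ := by ring
  have h6 : -m + (M + 1) / ε ≤ 1 / (2 * lam) := by
    rw [le_div_iff₀ (by positivity)]
    nlinarith [min_le_left m 0]
  have h7 := mul_le_mul_of_nonneg_right h6 (sq_nonneg r)
  have h8 : 1 / lam * r ^ 2 = 2 * (1 / (2 * lam) * r ^ 2) := by field_simp
  linarith

lemma norm_drift_zero_le (hσ : 0 < σ) (hε : 0 < ε) (hlam : 0 < lam) (hA : ‖A‖ ≤ K) :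
    ‖drift σ ε lam D S y A 0‖ ≤
      (σ ^ 2)⁻¹ * (|K| * ‖y‖) + 1 / ε * ‖D 0‖ + 1 / lam * ‖projOnto S 0‖ := by
  rw [drift, likelihoodScore_eq hσ]
  refine (norm_add₃_le).trans ?_
  rw [norm_smul, norm_smul, norm_smul, Real.norm_of_nonneg (by positivity : 0 ≤ (σ ^ 2)⁻¹),
    Real.norm_of_nonneg (by positivity : 0 ≤ 1 / ε),
    Real.norm_of_nonneg (by positivity : 0 ≤ 1 / lam), map_zero, sub_zero, sub_zero, sub_zero]
  gcongr
  refine (ContinuousLinearMap.le_opNorm _ _).trans ?_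
  rw [LinearIsometryEquiv.norm_map, norm_obsMap]
  gcongr
  exact hA.trans (le_abs_self _)

end drift

lemma tvDist_le_of_forall {d : ℕ} {μ ν : Measure (Euc d)} {c : ℝ}
    (h : ∀ f : Euc d → ℝ, Measurable f → (∀ x, |f x| ≤ 1) →
      |∫ x, f x ∂μ - ∫ x, f x ∂ν| ≤ c) : tvDist μ ν ≤ c := by
  refine csSup_le ⟨_, 0, measurable_const, fun x => by simp, rfl⟩ ?_
  rintro r ⟨f, hf, hf1, rfl⟩
  exact h f hf hf1

lemma tvDist_le_two {d : ℕ} {μ ν : Measure (Euc d)} [IsProbabilityMeasure μ]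
    [IsProbabilityMeasure ν] : tvDist μ ν ≤ 2 := by
  refine tvDist_le_of_forall fun f _ hf => ?_
  have key : ∀ (ρ : Measure (Euc d)) [IsProbabilityMeasure ρ], |∫ x, f x ∂ρ| ≤ 1 := by
    intro ρ _
    simpa using norm_integral_le_of_norm_le_const (μ := ρ) (f := f) (Eventually.of_forall hf)
  exact (abs_sub _ _).trans (by linarith [key μ, key ν])

end PnPULA

/-! ### Choice of constants and conclusion. -/

open MeasureTheory ProbabilityTheory PnPULA in
theorem corollary3 (d k : ℕ) (y : PnPULA.Euc k) (σ ε lam L M m K : ℝ)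
    (hσ : 0 < σ) (hε : 0 < ε) (hlam : 0 < lam) (hL : 0 < L) (hM : 0 ≤ M)
    (hparam : 2 * lam * (L + (M + 1) / ε - min m 0) ≤ 1)
    (D : PnPULA.Euc d → PnPULA.Euc d)
    (hD : ∀ x₁ x₂ : PnPULA.Euc d, ‖D x₁ - D x₂‖ ≤ M * ‖x₁ - x₂‖)
    (S : Set (PnPULA.Euc d)) (hSne : S.Nonempty) (hSconv : Convex ℝ S) (hScomp : IsCompact S) :
    ∃ A₄ B₄ : ℝ, 0 ≤ A₄ ∧ 0 ≤ B₄ ∧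
      ∀ A₁ A₂ : Matrix (Fin k) (Fin d) ℝ,
        ‖A₁‖ ≤ K → ‖A₂‖ ≤ K →
        PnPULA.ScoreLipschitz σ y L A₁ → PnPULA.ScoreLipschitz σ y L A₂ →
        PnPULA.ScoreMonotone σ y m A₁ → PnPULA.ScoreMonotone σ y m A₂ →
        ∀ δ : ℝ, 0 < δ → δ ≤ 1 / 3 * (L + (M + 1) / ε + 1 / lam)⁻¹ →
          ∀ π₁ π₂ : MeasureTheory.Measure (PnPULA.Euc d),
            PnPULA.IsInvariantLaw δ (PnPULA.drift σ ε lam D S y A₁) π₁ →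
            PnPULA.IsInvariantLaw δ (PnPULA.drift σ ε lam D S y A₂) π₂ →
            PnPULA.tvDist π₁ π₂ ≤ A₄ * ‖A₁ - A₂‖ + B₄ * δ ^ ((1 : ℝ) / 4) := by
  obtain ⟨R₀, hR₀⟩ := Metric.isBounded_iff.1 hScomp.isBounded
  have hR : ∀ p ∈ S, ∀ q ∈ S, ‖p - q‖ ≤ max R₀ 0 := fun p hp q hq => by
    rw [← dist_eq_norm]; exact (hR₀ hp hq).trans (le_max_left _ _)
  set R := max R₀ 0
  have hR0 : 0 ≤ R := le_max_right _ _
  have hβ : 0 ≤ R / lam := by positivity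
  have hα : 0 < 1 / (4 * lam) := by positivity
  obtain ⟨J, C, κ, δ₀, hJ, hC, hκ, hδ₀, hδ₀1, hstep⟩ := exists_potential (Euc d) hβ hα
  set l := L + (M + 1) / ε + 1 / lam with hl
  have hl0 : 0 < l := by positivity
  have hl1 : 1 / lam ≤ l := by
    have : 0 ≤ (M + 1) / ε := by positivity
    linarith
  have hl2 : l ≤ 3 / (2 * lam) := by
    have e : 3 / (2 * lam) = 1 / (2 * lam) + 1 / lam := by field_simp; norm_num
    have : L + (M + 1) / ε ≤ 1 / (2 * lam) := by
      rw [le_div_iff₀ (by positivity)]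
      nlinarith [min_le_right m 0]
    linarith
  -- `|K|` appears because the constants precede any matrix, and `K ≥ 0` follows only once one with
  -- norm at most `K` is given.
  set B₀ := (σ ^ 2)⁻¹ * (|K| * ‖y‖) + 1 / ε * ‖D 0‖ + 1 / lam * ‖projOnto S 0‖
  set mom := ∫ z, ‖z‖ ^ 2 ∂stdGaussian (Euc d)
  have hmom : 0 ≤ mom := integral_nonneg fun z => by positivity
  set q := (R / lam + B₀) / (1 / (4 * lam)) with hq
  set V := q ^ 2 + 2 * mom / (1 / (4 * lam)) with hV
  have hV0 : 0 ≤ V := by positivity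
  set Q := 2 * J + (1 + C * κ)
  have hQ0 : 0 ≤ Q := by positivity
  refine ⟨Q * ((σ ^ 2)⁻¹ * (‖y‖ + 2 * |K| * (1 + V))), 2 / δ₀ ^ ((1 : ℝ) / 4),
    by positivity, by positivity, ?_⟩
  intro A₁ A₂ hA₁ hA₂ hL₁ hL₂ hm₁ hm₂ δ hδ hδl π₁ π₂ hπ₁ hπ₂
  have := hπ₁.1
  have := hπ₂.1
  -- For `δ > δ₀` the second term already exceeds 2, the largest possible distance.
  rcases lt_or_ge δ₀ δ with hlarge | hsmall
  · have h1 : 0 ≤ Q * ((σ ^ 2)⁻¹ * (‖y‖ + 2 * |K| * (1 + V))) * ‖A₁ - A₂‖ := by positivity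
    have h2 : 2 ≤ 2 / δ₀ ^ ((1 : ℝ) / 4) * δ ^ ((1 : ℝ) / 4) := by
      rw [div_mul_eq_mul_div, le_div_iff₀ (by positivity)]
      gcongr
    linarith [tvDist_le_two (μ := π₁) (ν := π₂)]
  have hδl' : δ * l ≤ 1 / 3 := by
    have := mul_le_mul_of_nonneg_right hδl hl0.le
    rwa [mul_assoc, inv_mul_cancel₀ hl0.ne', mul_one] at this
  have hcont : ∀ A : Matrix (Fin k) (Fin d) ℝ, ScoreLipschitz σ y L A →
      Measurable (drift σ ε lam D S y A) := fun A hA => by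
    refine (LipschitzWith.of_dist_le_mul (K := l.toNNReal) fun u v => ?_).continuous.measurable
    rw [dist_eq_norm, dist_eq_norm, Real.coe_toNNReal _ hl0.le]
    exact norm_drift_sub_le hε hlam hD hSne hSconv hScomp hA u v
  have hcontr : ∀ A : Matrix (Fin k) (Fin d) ℝ, ScoreLipschitz σ y L A → ScoreMonotone σ y m A →
      ∀ u v, ‖(u + δ • drift σ ε lam D S y A u) - (v + δ • drift σ ε lam D S y A v)‖ ≤
        ‖u - v‖ + δ * (R / lam - 1 / (4 * lam) * ‖u - v‖) := fun A hLA hmA u v =>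
    norm_add_smul_sub_le hlam hβ hδ hl1 hl2 hδl'
      (inner_drift_sub_le hε hlam hL hparam hD hSne hScomp hR hmA u v)
      (norm_drift_sub_le hε hlam hD hSne hSconv hScomp hLA u v)
  have hmoment : ∀ A : Matrix (Fin k) (Fin d) ℝ, ‖A‖ ≤ K → ScoreLipschitz σ y L A →
      ScoreMonotone σ y m A → ∀ (π : Measure (Euc d)), IsInvariantLaw δ (drift σ ε lam D S y A) π →
      Integrable (fun x => ‖x‖) π ∧ ∫ x, ‖x‖ ∂π ≤ 1 + V := by
    intro A hAK hLA hmA π hπ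
    have := hπ.1
    have hθ1 : δ * (1 / (4 * lam)) ≤ 1 := by
      have h1 := mul_le_mul_of_nonneg_left hl1 hδ.le
      have e : 1 / (4 * lam) = 1 / 4 * (1 / lam) := by field_simp
      rw [e]
      linarith
    obtain ⟨hi, hle⟩ := integral_norm_sq_le_of_invariant (θ := δ * (1 / (4 * lam))) (q := q)
      (hcont A hLA) hδ (by positivity) hθ1 (fun x => by
        have h1 := hcontr A hLA hmA x 0
        have h2 := norm_drift_zero_le (D := D) (S := S) (y := y) hσ hε hlam hAK
        have h3 := norm_le_norm_sub_add (x + δ • drift σ ε lam D S y A x)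
          (0 + δ • drift σ ε lam D S y A 0)
        have h4 : ‖0 + δ • drift σ ε lam D S y A 0‖ ≤ δ * B₀ := by
          rw [zero_add, norm_smul, Real.norm_of_nonneg hδ.le]
          gcongr
        have e : δ * (1 / (4 * lam)) * q = δ * (R / lam + B₀) := by
          rw [hq]; field_simp
        rw [e]
        rw [sub_zero] at h1
        linarith) (isInvariantMeasure_of_isInvariantLaw (hcont A hLA) hπ)
    -- Noise and contraction per step are both proportional to `δ`, so the moment bound does not
    -- depend on it.
    have e : 2 * δ / (δ * (1 / (4 * lam))) * mom = 2 * mom / (1 / (4 * lam)) := by field_simp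
    rw [e, ← hV] at hle
    have hb : ∀ x : Euc d, ‖x‖ ≤ 1 + ‖x‖ ^ 2 := fun x => by nlinarith [sq_nonneg (‖x‖ - 1)]
    have hi' : Integrable (fun x : Euc d => 1 + ‖x‖ ^ 2) π := (integrable_const _).add hi
    have hn : Integrable (fun x : Euc d => ‖x‖) π :=
      hi'.mono' (by fun_prop) (Filter.Eventually.of_forall fun x => by
        rw [norm_norm]; exact hb x)
    refine ⟨hn, (integral_mono hn hi' hb).trans ?_⟩
    rw [integral_add (integrable_const _) hi]
    simpa using hle
  obtain ⟨hn₁, hV₁⟩ := hmoment A₁ hA₁ hL₁ hm₁ π₁ hπ₁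
  obtain ⟨hn₂, -⟩ := hmoment A₂ hA₂ hL₂ hm₂ π₂ hπ₂
  have hK : 0 ≤ K := (norm_nonneg _).trans hA₁
  have hdiff : ∀ x, ‖drift σ ε lam D S y A₁ x - drift σ ε lam D S y A₂ x‖ ≤
      (σ ^ 2)⁻¹ * (‖A₁ - A₂‖ * (‖y‖ + 2 * K * ‖x‖)) := fun x => by
    simp only [drift, add_sub_add_right_eq_sub]
    exact norm_likelihoodScore_sub_le hσ hA₁ hA₂ y x
  have hdom : Integrable (fun x => (σ ^ 2)⁻¹ * (‖A₁ - A₂‖ * (‖y‖ + 2 * K * ‖x‖))) π₁ :=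
    ((((integrable_const _).add (hn₁.const_mul _)).const_mul _).const_mul _)
  have hbi : Integrable (fun x => ‖drift σ ε lam D S y A₁ x - drift σ ε lam D S y A₂ x‖) π₁ :=
    hdom.mono' ((hcont A₁ hL₁).sub (hcont A₂ hL₂)).norm.aestronglyMeasurable
      (Filter.Eventually.of_forall fun x => by rw [norm_norm]; exact hdiff x)
  have hbint : ∫ x, ‖drift σ ε lam D S y A₁ x - drift σ ε lam D S y A₂ x‖ ∂π₁ ≤
      (σ ^ 2)⁻¹ * (‖A₁ - A₂‖ * (‖y‖ + 2 * |K| * (1 + V))) := by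
    refine (integral_mono hbi hdom hdiff).trans ?_
    rw [integral_const_mul, integral_const_mul, integral_add (integrable_const _)
      (hn₁.const_mul _), integral_const_mul, abs_of_nonneg hK]
    simp only [integral_const, probReal_univ, one_smul]
    gcongr
  have hTV : tvDist π₁ π₂ ≤
      Q * ∫ x, ‖drift σ ε lam D S y A₁ x - drift σ ε lam D S y A₂ x‖ ∂π₁ := by
    refine tvDist_le_of_forall fun f hf hf1 => ?_
    have hexp : ∀ t, 0 ≤ t → 0 ≤ 1 - Real.exp (-(κ * t)) := fun t ht => by
      have := Real.exp_le_one_iff.2 (neg_nonpos.2 (mul_nonneg hκ.le ht))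
      linarith
    -- `p` and `q` blow up as `δ → 0`, harmlessly: they are absent from the resulting bound.
    refine abs_integral_sub_le_of_invariant (Φ := potential J C κ δ) (p := J + C / δ) (q := 1 / δ)
      (hcont A₁ hL₁) (hcont A₂ hL₂) (fun t ht => ?_) (by positivity) (fun t ht => ?_)
      (fun g hg hM hosc u v huv => ?_) (fun g hg ⟨M', hM'⟩ hosc x => ?_)
      (isInvariantMeasure_of_isInvariantLaw (hcont A₁ hL₁) hπ₁)
      (isInvariantMeasure_of_isInvariantLaw (hcont A₂ hL₂) hπ₂) hn₁ hn₂ hbi hf hf1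
    · have := hexp t ht
      rw [potential]; positivity
    · rw [potential, add_assoc, div_mul_eq_mul_div, one_mul, ← add_div, add_comm C]
      gcongr
      linarith [mul_pos hC (Real.exp_pos (-(κ * t)))]
    · exact hstep δ hδ hsmall g hg hM hosc _ _ _ (norm_pos_iff.2 (sub_ne_zero.2 huv))
        (hcontr A₂ hL₂ hm₂ u v)
    · exact abs_integral_stdGaussian_sub_le_mul hg hM' hJ.le hC.le hδ (hsmall.trans hδ₀1) hosc x _ _
  have hB : 0 ≤ 2 / δ₀ ^ ((1 : ℝ) / 4) * δ ^ ((1 : ℝ) / 4) := by positivity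
  have := mul_le_mul_of_nonneg_left hbint hQ0
  linarith

end
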